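/- Let $q>3$ be a prime with $q\equiv 3 \pmod 4$, let $\mathbf k=\mathbb Q(\sqrt{-q})$, and let $\chi_q(x)=(x,-q)_q$ be the quadratic character of $\mathbb Q_q^\times$ given by the Hilbert symbol. Let $\psi_q(x)=e^{-2\pi i\{x\}_q}$ ($\{x\}_q$ the $q$-adic fractional part) be the component at $q$ of the standard additive character of $\mathbb Q_{\mathbb A}/\mathbb Q$ (with $\psi_\infty(x)=e^{2\pi i x}$). Let $V_q=\mathbf k_q=\mathbf k\otimes\mathbb Q_q$ with quadratic form $Q(x)=-N(x)$, let $\omega$ be the Weil representation of $SL_2(\mathbb Q_q)$ on $S(V_q)$ attached to $\psi_q$, and let $\varphi_q$ be the characteristic function of $\mathcal O_{\mathbf k}\otimes\mathbb Z_q$. For $g=n(b)m(a)k$ with $k\in SL_2(\mathbb Z_q)$, where $n(b)=\begin{pmatrix}1&b\\&1\end{pmatrix}$ and $m(a)=\begin{pmatrix}a&\\&a^{-1}\end{pmatrix}$, put $|a(g)|=|a|_q$, and let $\Phi_q(g,s)=(\omega(g)\varphi_q)(0)\,|a(g)|^s$ be the resulting standard (Iwahori-equivariant) section. With $w=\begin{pmatrix}&1\\-1&\end{pmatrix}$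 and $db$ the Haar measure on $\mathbb Q_q$ with $\mathrm{vol}(\mathbb Z_q)=1$, let, for an integer $t\neq 0$ and $\mathrm{Re}(s)>1$, $$W^*_{t,q}(s)=L_q(s+1,\chi)\int_{\mathbb Q_q}\Phi_q(w\,n(b),s)\,\psi_q(-tb)\,db,$$ where $L_q(s,\chi)$ is the local Euler factor of $\chi_q$ (equal to $1$, as $\chi_q$ is ramified). Let $\rho_q(t)$ be the number of ideals of $\mathcal O_{\mathbf k}$ of norm $q^{\mathrm{ord}_q(t)}$, and let $c_q=\sqrt{-1}\,q^{-1/2}$. Then the integral converges absolutely for $\mathrm{Re}(s)>1$, $W^*_{t,q}$ has an analytic continuation to an entire function, also denoted $W^*_{t,q}$, and for all $s\in\mathbb C$ $$W^*_{t,q}(s)=\bigl(1-\chi_q(t)\,q^{-s(\mathrm{ord}_q(t)+1)}\bigr)\,c_q .$$ Moreover $\rho_q(t)=1$. If $\chi_q(t)=-1$, then $W^*_{t,q}(0)=2c_q\,\rho_q(t)$. If $\chi_q(t)=1$, then $W^*_{t,q}(0)=0$ and $$W^{*,\prime}_{t,q}(0)=c_q\,\log(q)\,(\mathrm{ord}_q(t)+1)\,\rho_q(t).$$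 -/

import Mathlib

open MeasureTheory Filter Topology
open scoped NumberField

noncomputable section

namespace LocalWhittaker

/-! ### The field `ℚ_q`: Haar measure, additive character, Hilbert symbol -/

section Padic

instance instMeasurableSpacePadic (q : ℕ) [Fact q.Prime] : MeasurableSpace ℚ_[q] := borel _

instance instBorelSpacePadic (q : ℕ) [Fact q.Prime] : BorelSpace ℚ_[q] := ⟨rfl⟩

variable (q : ℕ) [Fact q.Prime]

/-- `ℤ_q` as a compact subset of `ℚ_q` with non-empty interior. -/
def integerBall : TopologicalSpace.PositiveCompacts ℚ_[q] where
  carrier := Metric.closedBall 0 1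
  isCompact' := isCompact_closedBall 0 1
  interior_nonempty' :=
    ⟨0, Metric.ball_subset_interior_closedBall (Metric.mem_ball_self one_pos)⟩

/-- The Haar measure on `ℚ_q` with `vol(ℤ_q) = 1`. This is the self-dual measure for every
additive character with conductor `ℤ_q`, in particular for `psi` below. -/
def haarQ : Measure ℚ_[q] := Measure.addHaarMeasure (integerBall q)

variable {q} in
/-- Every `x ∈ ℚ_q` is congruent modulo `ℤ_q` to an element of `ℤ[1/q]`. -/
theorem exists_fracPart (x : ℚ_[q]) :
    ∃ r : ℚ, (∃ (m : ℤ) (n : ℕ), r = m / (q : ℚ) ^ n) ∧ ‖x - (r : ℚ_[q])‖ ≤ 1 := by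
  have hq0 : (q : ℚ_[q]) ≠ 0 := by exact_mod_cast (Fact.out : q.Prime).ne_zero
  obtain ⟨n, hn⟩ : ∃ n : ℕ, ‖(q : ℚ_[q]) ^ n * x‖ ≤ 1 := by
    have h1 : Tendsto (fun n : ℕ => ‖(q : ℚ_[q])‖ ^ n * ‖x‖) atTop (𝓝 (0 * ‖x‖)) :=
      (tendsto_pow_atTop_nhds_zero_of_lt_one (norm_nonneg _) Padic.norm_p_lt_one).mul_const _
    rw [zero_mul] at h1
    obtain ⟨n, hn⟩ := (h1.eventually (gt_mem_nhds one_pos)).exists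
    exact ⟨n, by rw [norm_mul, norm_pow]; exact hn.le⟩
  let y : ℤ_[q] := ⟨(q : ℚ_[q]) ^ n * x, hn⟩
  obtain ⟨z, hz⟩ := Ideal.mem_span_singleton.mp (PadicInt.appr_spec n y)
  refine ⟨((y.appr n : ℤ) : ℚ) / (q : ℚ) ^ n, ⟨_, n, rfl⟩, ?_⟩
  have h2 : (q : ℚ_[q]) ^ n * x - (y.appr n : ℚ_[q]) = (q : ℚ_[q]) ^ n * (z : ℚ_[q]) := by
    have := congrArg (fun u : ℤ_[q] => (u : ℚ_[q])) hz
    simpa only [PadicInt.coe_sub, PadicInt.coe_natCast, PadicInt.coe_mul, PadicInt.coe_pow]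
      using this
  have h3 : x - ((((y.appr n : ℤ) : ℚ) / (q : ℚ) ^ n : ℚ) : ℚ_[q]) = (z : ℚ_[q]) := by
    push_cast
    have hqn : (q : ℚ_[q]) ^ n ≠ 0 := pow_ne_zero _ hq0
    apply mul_left_cancel₀ hqn
    rw [← h2, mul_sub, mul_div_cancel₀ _ hqn]
  rw [h3]
  exact z.2

variable {q} in
/-- The `q`-adic fractional part of `x`: a rational number in `ℤ[1/q]` congruent to `x` modulo
`ℤ_q`, well defined modulo `ℤ`. -/
def fracPart (x : ℚ_[q]) : ℚ := (exists_fracPart x).choose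

variable {q} in
/-- The local component at `q` of the standard additive character of `ℚ_𝔸 / ℚ`, whose component
at the real place is `x ↦ exp (2πix)`. -/
def psi (x : ℚ_[q]) : ℂ := Complex.exp (-2 * Real.pi * Complex.I * (fracPart x : ℂ))

open Classical in
/-- The Hilbert symbol `(a, b)` of a field: `1` if `z² = a x² + b y²` has a non-zero solution,
and `-1` otherwise. -/
def hilbertSymbol {F : Type*} [Field F] (a b : F) : ℤ :=
  if ∃ x y z : F, (x, y, z) ≠ 0 ∧ z ^ 2 = a * x ^ 2 + b * y ^ 2 then 1 else -1

variable {q} in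
/-- The quadratic character `χ_q(x) = (x, -q)_q`. -/
def chi (x : ℚ_[q]) : ℤ := hilbertSymbol x (-(q : ℚ_[q]))

open Classical in
/-- The local `L`-factor `L_q(s, χ)` of `χ_q`: it is `(1 - χ_q(q) q^{-s})⁻¹` if `χ_q` is
unramified, and `1` if `χ_q` is ramified. -/
def localLFactor (s : ℂ) : ℂ :=
  if ∀ u : ℤ_[q]ˣ, chi ((u : ℤ_[q]) : ℚ_[q]) = 1 then
    (1 - (chi (q : ℚ_[q]) : ℂ) * (q : ℂ) ^ (-s))⁻¹
  else 1

end Padic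

/-! ### The quadratic space `V_q = k_q` with `Q = -N`, for `k = ℚ(√-q)` -/

section QuadraticSpace

variable (q : ℕ) [Fact q.Prime]

/-- `V_q = k_q = ℚ_q(√-q)`; the element `⟨x, y⟩` is `x + y √-q`. -/
abbrev Vq : Type := QuadraticAlgebra ℚ_[q] (-(q : ℚ_[q])) 0

instance instMeasurableSpaceVq : MeasurableSpace (Vq q) :=
  MeasurableSpace.comap (QuadraticAlgebra.equivProd (-(q : ℚ_[q])) 0) inferInstance

variable {q} in
/-- The quadratic form `Q(x) = -N(x)` on `V_q`. -/
def quadForm (x : Vq q) : ℚ_[q] := -QuadraticAlgebra.norm x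

/-- The Haar measure on `V_q` that is self-dual with respect to `ψ_q` and the bilinear form
`(x, y) = Q(x + y) - Q(x) - Q(y)`. In the basis `1, √-q` the Gram matrix of this form is
`diag (-2, -2q)`, of determinant `4q`, so the self-dual measure is `|4q|^{1/2} dx dy`. -/
def haarV : Measure (Vq q) :=
  ENNReal.ofReal (Real.sqrt ‖(4 * q : ℚ_[q])‖) •
    Measure.map (QuadraticAlgebra.equivProd (-(q : ℚ_[q])) 0).symm ((haarQ q).prod (haarQ q))

/-- `R_q = 𝓞_k ⊗ ℤ_q`, the ring of integers of `k_q`. -/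
def Rq : Set (Vq q) := {x | IsIntegral ℤ_[q] x}

/-- `φ_q`, the characteristic function of `R_q`. -/
def phi : Vq q → ℂ := (Rq q).indicator 1

/-- The Weil index `γ(ψ_q ∘ Q)`: the limit of the integrals of `ψ_q(Q(x))` over the lattices
`q^{-n} R_q` (the sequence is eventually constant). -/
def weilIndex : ℂ :=
  limUnder atTop fun n : ℕ =>
    ∫ x in {x : Vq q | (q : ℚ_[q]) ^ n • x ∈ Rq q}, psi (quadForm x) ∂(haarV q)

end QuadraticSpace

/-! ### The Weil representation and the section `Φ_q(s)` -/

section Section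

variable {q : ℕ} [Fact q.Prime]

/-- `n(b) = (1 b; 0 1)`. -/
def nMat (b : ℚ_[q]) : Matrix.SpecialLinearGroup (Fin 2) ℚ_[q] :=
  ⟨!![1, b; 0, 1], by simp [Matrix.det_fin_two]⟩

/-- `m(a) = (a 0; 0 a⁻¹)`. -/
def mMat (a : ℚ_[q]ˣ) : Matrix.SpecialLinearGroup (Fin 2) ℚ_[q] :=
  ⟨!![(a : ℚ_[q]), 0; 0, ((a⁻¹ : ℚ_[q]ˣ) : ℚ_[q])], by simp [Matrix.det_fin_two]⟩

variable (q) in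
/-- `w = (0 1; -1 0)`. -/
def wMat : Matrix.SpecialLinearGroup (Fin 2) ℚ_[q] :=
  ⟨!![0, 1; -1, 0], by simp [Matrix.det_fin_two]⟩

open Classical in
/-- The Weil representation `ω = ω_{ψ_q}` of `SL₂(ℚ_q)` on functions on `V_q`, for
`g = (a b; c d)`. It is determined by
`ω(n(b))φ(x) = ψ(b Q(x)) φ(x)`, `ω(m(a))φ(x) = χ(a)|a| φ(ax)` and
`ω(w)φ(x) = χ(-1) γ(ψ ∘ Q)⁻¹ ∫ φ(y) ψ((x, y)) dy`, through the decompositions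
`g = n(ab) m(a)` if `c = 0` and `g = n(a/c) m(-1/c) w n(d/c)` if `c ≠ 0`. -/
def weilRep (g : Matrix.SpecialLinearGroup (Fin 2) ℚ_[q]) (φ : Vq q → ℂ) (x : Vq q) : ℂ :=
  if g.1 1 0 = 0 then
    (chi (g.1 0 0) : ℂ) * (‖g.1 0 0‖ : ℂ) * psi (g.1 0 0 * g.1 0 1 * quadForm x) *
      φ (g.1 0 0 • x)
  else
    (weilIndex q)⁻¹ * (chi (g.1 1 0) : ℂ) * (‖g.1 1 0‖ : ℂ)⁻¹ *
      ∫ y, psi ((g.1 0 0 * quadForm x - QuadraticMap.polar quadForm x y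
        + g.1 1 1 * quadForm y) / g.1 1 0) * φ y ∂(haarV q)

/-- The quantity `|a(g)|` of an Iwasawa decomposition `g = n(b) m(a) k`, `k ∈ SL₂(ℤ_q)`, computed
from the bottom row of `g`. -/
def iwasawaHeight (g : Matrix.SpecialLinearGroup (Fin 2) ℚ_[q]) : ℝ :=
  (max ‖g.1 1 0‖ ‖g.1 1 1‖)⁻¹

theorem iwasawaHeight_eq (b : ℚ_[q]) (a : ℚ_[q]ˣ)
    (k : Matrix.SpecialLinearGroup (Fin 2) ℤ_[q]) :
    iwasawaHeight (nMat b * mMat a * k.map PadicInt.Coe.ringHom) = ‖(a : ℚ_[q])‖ := by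
  have hbot : ∀ i, (nMat b * mMat a * k.map PadicInt.Coe.ringHom).1 1 i
      = (a : ℚ_[q])⁻¹ * ((k.1 1 i : ℤ_[q]) : ℚ_[q]) := by
    intro i
    change ((!![1, b; 0, 1] * !![(a : ℚ_[q]), 0; 0, ((a⁻¹ : ℚ_[q]ˣ) : ℚ_[q])]) *
      (k.1.map PadicInt.Coe.ringHom)) 1 i = _
    simp [Matrix.mul_apply, Fin.sum_univ_two]
    rfl
  have hk : max ‖((k.1 1 0 : ℤ_[q]) : ℚ_[q])‖ ‖((k.1 1 1 : ℤ_[q]) : ℚ_[q])‖ = 1 := by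
    apply le_antisymm (max_le (k.1 1 0).2 (k.1 1 1).2)
    by_contra hlt
    obtain ⟨h0, h1⟩ := max_lt_iff.mp (not_le.mp hlt)
    have hdet : k.1 0 0 * k.1 1 1 - k.1 0 1 * k.1 1 0 = 1 := by
      rw [← Matrix.det_fin_two]; exact k.2
    have hd : (1 : ℤ_[q]) ∈ IsLocalRing.maximalIdeal ℤ_[q] := by
      rw [← hdet]
      have key : ∀ z : ℤ_[q], ‖z‖ < 1 → z ∈ IsLocalRing.maximalIdeal ℤ_[q] := fun z hz =>
        (IsLocalRing.mem_maximalIdeal z).mpr (PadicInt.mem_nonunits.mpr hz)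
      exact Ideal.sub_mem _ (Ideal.mul_mem_left _ _ (key _ h1)) (Ideal.mul_mem_left _ _ (key _ h0))
    exact (Ideal.ne_top_iff_one _).mp (IsLocalRing.maximalIdeal.isMaximal ℤ_[q]).ne_top hd
  rw [iwasawaHeight, hbot, hbot, norm_mul, norm_mul, ← mul_max_of_nonneg _ _ (norm_nonneg _), hk,
    mul_one, norm_inv, inv_inv]

/-- The standard section `Φ_q(g, s) = λ(φ_q)(g) |a(g)|^s`, where `λ(φ_q)(g) = (ω(g) φ_q)(0)`. -/
def sectionPhi (g : Matrix.SpecialLinearGroup (Fin 2) ℚ_[q]) (s : ℂ) : ℂ :=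
  weilRep g (phi q) 0 * ((iwasawaHeight g : ℝ) : ℂ) ^ s

/-- The integrand `Φ_q(w n(b) g, s) ψ_q(-tb)` of the local Whittaker integral. -/
def whittakerIntegrand (t : ℚ_[q]) (g : Matrix.SpecialLinearGroup (Fin 2) ℚ_[q]) (s : ℂ)
    (b : ℚ_[q]) : ℂ :=
  sectionPhi (wMat q * nMat b * g) s * psi (-(t * b))

/-- The local Whittaker integral `W_{t,q}(g, s, Φ_q)`. -/
def whittaker (t : ℚ_[q]) (g : Matrix.SpecialLinearGroup (Fin 2) ℚ_[q]) (s : ℂ) : ℂ :=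
  ∫ b, whittakerIntegrand t g s b ∂(haarQ q)

/-- `W` is the normalized local Whittaker function `W*_{t,q}`: the entire function of `s` which is
`L_q(s + 1, χ) W_{t,q}(e, s, Φ_q)` for `Re s > 1`. -/
structure IsNormalizedWhittaker (t : ℚ_[q]) (W : ℂ → ℂ) : Prop where
  entire : Differentiable ℂ W
  eq_integral : ∀ s : ℂ, 1 < s.re → W s = localLFactor q (s + 1) * whittaker t 1 s

end Section

/-! ### Ideals of given norm in `𝓞_k` -/

section Ideals

variable (q : ℕ) [Fact q.Prime]

instance instFactNotSquare : Fact (∀ r : ℚ, r ^ 2 ≠ -(q : ℚ) + 0 * r) :=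
  ⟨fun r h => by
    have hq : (0 : ℚ) < q := by exact_mod_cast (Fact.out : q.Prime).pos
    nlinarith [sq_nonneg r]⟩

/-- The imaginary quadratic field `k = ℚ(√-q)`. -/
abbrev kField : Type := QuadraticAlgebra ℚ (-(q : ℚ)) 0

instance instNumberFieldK : NumberField (kField q) where
  to_charZero := algebraRat.charZero _
  to_finiteDimensional := by
    convert! (inferInstance : Module.Finite ℚ (QuadraticAlgebra ℚ (-(q : ℚ)) 0))

/-- `ρ(n)`, the number of ideals of `𝓞_k` of norm `n`. -/
def rho (n : ℕ) : ℕ := Nat.card {I : Ideal (𝓞 (kField q)) // Ideal.absNorm I = n}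

/-- `ρ_q(t) = ρ(q^{ord_q(t)})`. -/
def rhoLocal (t : ℤ) : ℕ := rho q (q ^ padicValInt q t)

end Ideals

/-- `c_q = √-1 q^{-1/2}`. -/
def cq (q : ℕ) : ℂ := Complex.I * ((Real.sqrt q : ℝ) : ℂ)⁻¹

end LocalWhittaker

end

noncomputable section

namespace LocalWhittaker

/-! ### The sign of the quadratic Gauss sum -/

section GaussSign

open Polynomial Finset

/-! The bottom row of `w n(b)` is `(-1, -b)`, so `Φ_q(w n(b), s)` is a constant times `max(1,
|b|)^{-s}` times the integral of `ψ(-b(x² + q y²))` over `ℤ_q × ℤ_q`. The constant is `γ⁻¹ χ(-1)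
q^{-1/2} = i⁻¹ · (-1) · q^{-1/2} = c_q`.

The double integral is a product of two Gauss integrals (`normIntegral`). It is `1` for `|b| ≤ 1`,
and `q^{-k} (z/q) i√q` for `b = z q^{-k}` with `z` a unit and `k ≥ 1`. On the sphere `|b| = q^k` the
Whittaker integrand is therefore a constant times the residue character of `q^k b` times `ψ(-tb)`.
Rescaling gives `charIntegral (-t/q^k)`, which vanishes unless `|t/q^k| = q`, that is, unless `k =
ord_q(t) + 1`.

So only two pieces of `ℚ_q` contribute: `ℤ_q` gives `c_q`, and that one sphere gives `-χ_q(t)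
q^{-s(ord_q(t)+1)} c_q`. Its sign is the square of `i`, since two Gauss sums meet there. The result
is entire in `s`, and the identity theorem makes it the only continuation; the value and derivative
at `0` are read off.

Three inputs remain. The sign of the quadratic Gauss sum (`gaussSum_quadraticChar_stdAddChar`) is
needed for `γ = i`, hence for `c_q` itself. Since `q` is the norm of `√-q`, `χ_q(q^n u)` is the
Legendre symbol of `u` (`chi_prime_pow_mul`). Finally `ρ_q(t) = 1` because `q` ramifies
(`rho_prime_pow`). -/

theorem sum_eval_of_monic_natDegree_eq_card_sub_one {K : Type*} [Field K] [Fintype K]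
    (F : K[X]) (hF : F.Monic) (hd : F.natDegree = Fintype.card K - 1) :
    ∑ x : K, F.eval x = -1 := by
  classical
  have h1 : 0 < Fintype.card K - 1 := Nat.sub_pos_of_lt Fintype.one_lt_card
  simp_rw [eval_eq_sum_range, hd, Finset.sum_range_succ]
  rw [Finset.sum_add_distrib, Finset.sum_comm]
  have hz : ∑ i ∈ range (Fintype.card K - 1), ∑ x : K, F.coeff i * x ^ i = 0 := by
    refine Finset.sum_eq_zero fun i hi => ?_
    rw [← Finset.mul_sum, FiniteField.sum_pow_lt_card_sub_one K i (mem_range.mp hi), mul_zero]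
  have hc : F.coeff (Fintype.card K - 1) = 1 := by rw [← hd]; exact hF
  have hs : ∑ x : K, x ^ (Fintype.card K - 1) = -1 := by
    have h2 : ∀ x : K, x ^ (Fintype.card K - 1) = 1 - if x = 0 then 1 else 0 := by
      intro x
      by_cases hx : x = 0
      · simp [hx, h1.ne']
      · simp [hx, FiniteField.pow_card_sub_one_eq_one x hx]
    simp_rw [h2]
    simp
  rw [hz, zero_add, hc]
  simpa using hs

theorem taylor_coeff_X_sub_one_pow_mul {R : Type*} [CommRing R] (m : ℕ) (H : R[X]) :
    (taylor 1 ((X - 1) ^ m * H)).coeff m = H.eval 1 := by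
  have : (taylor (1 : R)) (X - 1 : R[X]) = X := by simp
  rw [taylor_mul, taylor_pow, this, coeff_X_pow_mul', if_pos le_rfl, Nat.sub_self,
    taylor_coeff_zero]

variable (p : ℕ)

/-- The polynomial `∏ X ^ (m k) (X ^ k - 1)` with `m = (p - 1) / 2` and `1 ≤ k ≤ m`. -/
def sineProdPoly : ℤ[X] := ∏ k ∈ range (p / 2), X ^ (p / 2 * (k + 1)) * (X ^ (k + 1) - 1)

/-- Each factor `X^k - 1` is `X - 1` times a geometric sum with value `k` at `1`, so the lowest
Taylor coefficient at `1` is the product of these `k`. -/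
theorem taylor_coeff_sineProdPoly {R : Type*} [CommRing R] :
    (taylor 1 ((sineProdPoly p).map (Int.castRingHom R))).coeff (p / 2) =
      ((p / 2).factorial : R) := by
  have h : (sineProdPoly p).map (Int.castRingHom R) = (X - 1) ^ (p / 2) *
      ∏ k ∈ range (p / 2), (X ^ (p / 2 * (k + 1)) * ∑ i ∈ range (k + 1), X ^ i) := by
    rw [sineProdPoly, Polynomial.map_prod]
    rw [show (X - 1 : R[X]) ^ (p / 2) = ∏ _k ∈ range (p / 2), (X - 1 : R[X]) by simp,
      ← prod_mul_distrib]
    refine prod_congr rfl fun k _ => ?_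
    simp only [Polynomial.map_mul, Polynomial.map_pow, map_X, Polynomial.map_sub,
      Polynomial.map_one]
    rw [← mul_geom_sum]
    ring
  rw [h, taylor_coeff_X_sub_one_pow_mul, eval_prod, ← prod_range_add_one_eq_factorial]
  push_cast
  simp [eval_finsetSum]

variable [Fact p.Prime]

/-- The polynomial `∑ (x / p) X ^ x` whose value at a root of unity is a quadratic Gauss sum. -/
def gaussPoly : ℤ[X] := ∑ x : ZMod p, C (quadraticChar (ZMod p) x) * X ^ x.val

/-- Let `m = (p-1)/2`. Modulo `p` the character is `x^m` (Euler), and the `m`-th Taylor coefficient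
of `X^x` at `1` is `x.choose m`, which becomes the falling factorial after multiplying by `m!`. The
sum is thus that of a monic polynomial of degree `2m = p - 1` over all residues, and only its
leading term survives. -/
theorem factorial_mul_taylor_coeff_gaussPoly (hp : p ≠ 2) :
    ((p / 2).factorial : ZMod p) *
      (taylor 1 ((gaussPoly p).map (Int.castRingHom (ZMod p)))).coeff (p / 2) = -1 := by
  have hodd : p = 2 * (p / 2) + 1 := by
    have := (Fact.out : p.Prime).eq_two_or_odd
    omega
  rw [← sum_eval_of_monic_natDegree_eq_card_sub_one (X ^ (p / 2) * descPochhammer (ZMod p) (p / 2))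
    ((monic_X_pow _).mul (monic_descPochhammer _ _))]
  · rw [gaussPoly, Polynomial.map_sum, map_sum, finsetSum_coeff, mul_sum]
    refine sum_congr rfl fun x _ => ?_
    have h1 : ((quadraticChar (ZMod p) x : ℤ) : ZMod p) = x ^ (p / 2) := by
      have := quadraticChar_eq_pow_of_char_ne_two' (F := ZMod p) (by rwa [ZMod.ringChar_zmod_n]) x
      rwa [ZMod.card] at this
    rw [Polynomial.map_mul, map_C, Polynomial.map_pow, map_X, C_mul_X_pow_eq_monomial, taylor_coeff,
      hasseDeriv_monomial, eval_monomial, one_pow, mul_one, eval_mul, eval_pow, eval_X]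
    simp only [eq_intCast, h1]
    have h2 : (descPochhammer (ZMod p) (p / 2)).eval x
        = ((p / 2).factorial : ZMod p) * (x.val.choose (p / 2) : ZMod p) := by
      conv_lhs => rw [← ZMod.natCast_zmod_val x]
      rw [descPochhammer_eval_eq_descFactorial, Nat.descFactorial_eq_factorial_mul_choose,
        Nat.cast_mul]
    rw [h2]
    ring
  · rw [natDegree_mul (pow_ne_zero _ X_ne_zero) (monic_descPochhammer _ _).ne_zero, natDegree_X_pow,
      descPochhammer_natDegree, ZMod.card]
    omega

/-- The wrong sign would make the cyclotomic polynomial divide the difference of the two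
polynomials. Modulo `p` it becomes `(X - 1)^(p-1)`, so the Taylor coefficients at `1` of order `m =
(p-1)/2` would agree. This gives `(m!)² = -1` in `ZMod p`, impossible for `p ≡ 3 mod 4`. -/
theorem eq_of_aeval_gaussPoly (hp : p % 4 = 3) {ζ : ℂ} (hζ : IsPrimitiveRoot ζ p)
    (h : aeval ζ (gaussPoly p) ^ 2 = aeval ζ (sineProdPoly p) ^ 2) :
    aeval ζ (gaussPoly p) = -aeval ζ (sineProdPoly p) := by
  rcases sq_eq_sq_iff_eq_or_eq_neg.mp h with h | h
  swap
  · exact h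
  exfalso
  have hpp : p.Prime := Fact.out
  have hdvd : cyclotomic p ℤ ∣ gaussPoly p - sineProdPoly p := by
    rw [cyclotomic_eq_minpoly hζ hpp.pos]
    refine minpoly.isIntegrallyClosed_dvd (hζ.isIntegral hpp.pos) ?_
    rw [map_sub, h, sub_self]
  have hdvd2 : (X - 1 : (ZMod p)[X]) ^ (p / 2 + 1) ∣
      (gaussPoly p - sineProdPoly p).map (Int.castRingHom (ZMod p)) := by
    have h1 := Polynomial.map_dvd (Int.castRingHom (ZMod p)) hdvd
    rw [map_cyclotomic] at h1
    have h2 : cyclotomic p (ZMod p) = (X - 1) ^ (p - 1) := by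
      have h3 := cyclotomic_prime_mul_X_sub_one (ZMod p) p
      rw [← one_pow (M := (ZMod p)[X]) p, ← sub_pow_char, one_pow] at h3
      apply mul_right_cancel₀ (b := (X - 1 : (ZMod p)[X]))
      · simpa using X_sub_C_ne_zero (1 : ZMod p)
      · rw [h3, ← pow_succ, Nat.sub_add_cancel hpp.one_le]
    rw [h2] at h1
    exact (pow_dvd_pow _ (by omega)).trans h1
  obtain ⟨K, hK⟩ := hdvd2
  have h4 : (taylor 1 ((gaussPoly p).map (Int.castRingHom (ZMod p)))).coeff (p / 2) =
      (taylor 1 ((sineProdPoly p).map (Int.castRingHom (ZMod p)))).coeff (p / 2) := by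
    rw [← sub_eq_zero, ← coeff_sub, ← map_sub, ← Polynomial.map_sub, hK, pow_succ, mul_assoc,
      taylor_coeff_X_sub_one_pow_mul]
    simp
  have h5 := factorial_mul_taylor_coeff_gaussPoly p (by omega)
  rw [h4, taylor_coeff_sineProdPoly] at h5
  exact ZMod.exists_sq_eq_neg_one_iff.mp ⟨_, h5.symm⟩ hp

/-- With `θ = πk/p`, the factor `X^(mk)` takes the value `(-1)^k e^{-iθ}`; it symmetrizes `ζ^k - 1 =
e^{2iθ} - 1` into `(-1)^k · 2i sin θ`. -/
theorem aeval_sineProdPoly_exp (hp : p % 4 = 3) :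
    aeval (Complex.exp (2 * Real.pi * Complex.I / p)) (sineProdPoly p) =
      -Complex.I * ((∏ k ∈ range (p / 2), 2 * Real.sin (Real.pi * (k + 1) / p) : ℝ) : ℂ) := by
  have hp0 : (p : ℂ) ≠ 0 := by exact_mod_cast (Fact.out : p.Prime).ne_zero
  have hfac : ∀ k : ℕ, aeval (Complex.exp (2 * Real.pi * Complex.I / p))
      (X ^ (p / 2 * (k + 1)) * (X ^ (k + 1) - 1) : ℤ[X]) =
      (-1) ^ (k + 1) * Complex.I * ((2 * Real.sin (Real.pi * (k + 1) / p) : ℝ) : ℂ) := by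
    intro k
    set θ : ℂ := Real.pi * (k + 1) / p with hθ
    have e1 : Complex.exp (2 * Real.pi * Complex.I / p) ^ (p / 2 * (k + 1)) =
        (-1) ^ (k + 1) * Complex.exp (-θ * Complex.I) := by
      rw [← Complex.exp_pi_mul_I, ← Complex.exp_nat_mul, ← Complex.exp_nat_mul, ← Complex.exp_add]
      congr 1
      have hm : ((p / 2 : ℕ) : ℂ) = (p - 1) / 2 := by
        have : p = 2 * (p / 2) + 1 := by omega
        have : (p : ℂ) = 2 * (p / 2 : ℕ) + 1 := by exact_mod_cast this
        rw [this]; ring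
      push_cast
      rw [hm, hθ]
      field_simp
      ring
    have e2 : Complex.exp (2 * Real.pi * Complex.I / p) ^ (k + 1) =
        Complex.exp (θ * Complex.I) * Complex.exp (θ * Complex.I) := by
      rw [← Complex.exp_add, ← Complex.exp_nat_mul]
      congr 1
      push_cast
      rw [hθ]
      field_simp
      ring
    have e3 : Complex.exp (-θ * Complex.I) * Complex.exp (θ * Complex.I) = 1 := by
      rw [← Complex.exp_add]; simp
    have e4 : ((2 * Real.sin (Real.pi * (k + 1) / p) : ℝ) : ℂ) =
        (Complex.exp (-θ * Complex.I) - Complex.exp (θ * Complex.I)) * Complex.I := by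
      push_cast
      rw [← hθ, Complex.sin]
      ring
    simp only [map_mul, map_pow, aeval_X, map_sub, map_one]
    rw [e1, e2, e4]
    linear_combination (-1) ^ (k + 1) * (Complex.exp (θ * Complex.I)) * e3 -
      (-1) ^ (k + 1) * (Complex.exp (-θ * Complex.I) - Complex.exp (θ * Complex.I)) * Complex.I_sq
  -- The number of factors `p / 2` is odd because `p ≡ 3 mod 4`. The first factor is `-i`, and each
  -- further consecutive pair multiplies to `i · (-i) = 1`.
  have hsign : ∀ n : ℕ, ∏ k ∈ range (2 * n + 1), ((-1) ^ (k + 1) * Complex.I) = -Complex.I := by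
    intro n
    induction n with
    | zero => simp
    | succ n ih =>
      rw [show 2 * (n + 1) + 1 = (2 * n + 1) + 1 + 1 by ring, prod_range_succ, prod_range_succ, ih]
      have h2 : ((-1 : ℂ)) ^ (2 * n) = 1 := by rw [pow_mul]; simp
      simp only [pow_succ, h2]
      linear_combination Complex.I * Complex.I_sq
  rw [sineProdPoly, map_prod]
  simp_rw [hfac]
  rw [prod_mul_distrib, show p / 2 = 2 * (p / 4) + 1 by omega, hsign]
  push_cast
  rfl

theorem prod_two_mul_sin_pos :
    0 < ∏ k ∈ range (p / 2), 2 * Real.sin (Real.pi * (k + 1) / p) := by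
  have hp : (0 : ℝ) < p := by exact_mod_cast (Fact.out : p.Prime).pos
  refine prod_pos fun k hk => mul_pos two_pos (Real.sin_pos_of_pos_of_lt_pi (by positivity) ?_)
  rw [div_lt_iff₀ hp]
  have hk2 : k + 1 < p := by
    have := mem_range.mp hk
    omega
  exact mul_lt_mul_of_pos_left (by exact_mod_cast hk2) Real.pi_pos

/-- The symmetry `sin(π - x) = sin x` turns the square into the product over all `1 ≤ k ≤ p - 1`.
Since `2 sin(πk/p) = |1 - ζ^k|`, that product is the absolute value of the cyclotomic polynomial at
`1`, namely `p`. -/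
theorem prod_two_mul_sin_sq (hp2 : p ≠ 2) :
    (∏ k ∈ range (p / 2), 2 * Real.sin (Real.pi * (k + 1) / p)) ^ 2 = p := by
  have hpp : p.Prime := Fact.out
  have hp : (0 : ℝ) < p := by exact_mod_cast hpp.pos
  have hodd : p = p / 2 + p / 2 + 1 := by
    have := hpp.eq_two_or_odd
    omega
  have h1 : (∏ k ∈ range (p / 2), 2 * Real.sin (Real.pi * (k + 1) / p)) ^ 2 =
      ∏ k ∈ range (p - 1), 2 * Real.sin (Real.pi * (k + 1) / p) := by
    rw [show p - 1 = p / 2 + p / 2 by omega, prod_range_add, sq]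
    congr 1
    rw [← prod_range_reflect]
    refine prod_congr rfl fun k hk => ?_
    rw [← Real.sin_pi_sub]
    congr 2
    have hk := mem_range.mp hk
    have : ((p / 2 - 1 - k : ℕ) : ℝ) + ((p / 2 + k : ℕ) : ℝ) + 2 = p := by
      norm_cast
      omega
    rw [← this]
    have : ((p / 2 - 1 - k : ℕ) : ℝ) + ((p / 2 + k : ℕ) : ℝ) + 2 ≠ 0 := by positivity
    field_simp
    ring
  have hζ := Complex.isPrimitiveRoot_exp p hpp.ne_zero
  have h2 : ∏ k ∈ range (p - 1), (1 - Complex.exp (2 * Real.pi * Complex.I / p) ^ (k + 1)) = p := by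
    have h3 := X_pow_sub_C_eq_prod hζ hpp.pos (one_pow p)
    have h6 : range p = range (p - 1 + 1) := by rw [Nat.sub_add_cancel hpp.one_le]
    rw [h6, prod_range_succ'] at h3
    simp only [mul_one, pow_zero, map_one] at h3
    rw [← cyclotomic_prime_mul_X_sub_one] at h3
    have h4 := mul_right_cancel₀ (by simpa using X_sub_C_ne_zero (1 : ℂ)) h3
    have h5 := congrArg (Polynomial.eval 1) h4
    rw [eval_one_cyclotomic_prime, eval_prod] at h5
    simpa using h5.symm
  have h3 := congrArg norm h2
  rw [norm_prod, Complex.norm_natCast] at h3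
  refine h1.trans (Eq.trans ?_ h3)
  refine prod_congr rfl fun k hk => ?_
  have hk := mem_range.mp hk
  have h4 : Complex.exp (2 * Real.pi * Complex.I / p) ^ (k + 1) =
      Complex.exp (Complex.I * ((2 * (Real.pi * (k + 1) / p) : ℝ) : ℂ)) := by
    rw [← Complex.exp_nat_mul]
    congr 1
    push_cast
    ring
  rw [norm_sub_rev, h4, Complex.norm_exp_I_mul_ofReal_sub_one, mul_div_cancel_left₀ _ two_ne_zero,
    Real.norm_of_nonneg]
  refine mul_nonneg two_pos.le (Real.sin_nonneg_of_nonneg_of_le_pi (by positivity) ?_)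
  rw [div_le_iff₀ hp]
  have hk2 : k + 1 ≤ p := by omega
  exact mul_le_mul_of_nonneg_left (by exact_mod_cast hk2) Real.pi_pos.le

theorem gaussSum_stdAddChar_eq_aeval :
    gaussSum ((quadraticChar (ZMod p)).ringHomComp (Int.castRingHom ℂ)) ZMod.stdAddChar =
      aeval (Complex.exp (2 * Real.pi * Complex.I / p)) (gaussPoly p) := by
  rw [gaussSum, gaussPoly, map_sum]
  refine sum_congr rfl fun x _ => ?_
  have h := ZMod.stdAddChar_coe (N := p) (x.val : ℤ)
  rw [Int.cast_natCast, ZMod.natCast_zmod_val] at h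
  rw [map_mul, map_pow, aeval_X, h, ← Complex.exp_nat_mul]
  rw [aeval_C, MulChar.ringHomComp_apply, algebraMap_int_eq]
  congr 2
  push_cast
  ring

/-- Gauss: for a prime `p ≡ 3 mod 4`, the quadratic Gauss sum is `i √p`. -/
theorem gaussSum_quadraticChar_stdAddChar (hp : p % 4 = 3) :
    gaussSum ((quadraticChar (ZMod p)).ringHomComp (Int.castRingHom ℂ)) ZMod.stdAddChar =
      Complex.I * (Real.sqrt p : ℝ) := by
  have hp2 : p ≠ 2 := by omega
  have hchar : ringChar (ZMod p) ≠ 2 := by rwa [ZMod.ringChar_zmod_n]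
  have hsq := gaussSum_sq (χ := (quadraticChar (ZMod p)).ringHomComp (Int.castRingHom ℂ))
    ((MulChar.ringHomComp_ne_one_iff (Int.cast_injective)).mpr (quadraticChar_ne_one hchar))
    ((quadraticChar_isQuadratic (ZMod p)).comp _) (ZMod.isPrimitive_stdAddChar p)
  have hneg : quadraticChar (ZMod p) (-1) = -1 := by
    rw [quadraticChar_neg_one_iff_not_isSquare, ZMod.exists_sq_eq_neg_one_iff]
    simpa using hp
  have hpos := prod_two_mul_sin_pos p
  have hr := prod_two_mul_sin_sq p hp2
  have hP := aeval_sineProdPoly_exp p hp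
  rw [← hr, Real.sqrt_sq hpos.le]
  rw [gaussSum_stdAddChar_eq_aeval] at hsq ⊢
  rw [MulChar.ringHomComp_apply, hneg, ZMod.card] at hsq
  have hζ := Complex.isPrimitiveRoot_exp p (Fact.out : p.Prime).ne_zero
  rw [eq_of_aeval_gaussPoly p hp hζ, hP]
  · ring
  · rw [hsq, hP, mul_pow, ← Complex.ofReal_pow, hr]
    simp

end GaussSign

/-! ### The additive character -/

section AdditiveCharacter

variable {q : ℕ} [Fact q.Prime]

theorem norm_sub_le_max' (x y : ℚ_[q]) : ‖x - y‖ ≤ max ‖x‖ ‖y‖ := by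
  rw [sub_eq_add_neg, ← norm_neg y]
  exact IsUltrametricDist.norm_add_le_max _ _

theorem exists_padicInt_coe_eq {x : ℚ_[q]} (hx : ‖x‖ ≤ 1) : ∃ z : ℤ_[q], (z : ℚ_[q]) = x :=
  ⟨⟨x, hx⟩, rfl⟩

theorem natCast_prime_ne_zero : (q : ℚ_[q]) ≠ 0 := by
  exact_mod_cast (Fact.out : q.Prime).ne_zero

theorem exists_int_of_norm_le_one {r : ℚ} (hr : ∃ (m : ℤ) (n : ℕ), r = m / (q : ℚ) ^ n)
    (h : ‖(r : ℚ_[q])‖ ≤ 1) : ∃ k : ℤ, r = k := by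
  obtain ⟨m, n, rfl⟩ := hr
  have hq : (q : ℚ) ≠ 0 := by exact_mod_cast (Fact.out : q.Prime).ne_zero
  have hqr : (0 : ℝ) < q := by exact_mod_cast (Fact.out : q.Prime).pos
  have h1 : ‖(m : ℚ_[q])‖ ≤ (q : ℝ) ^ (-n : ℤ) := by
    push_cast at h
    rw [norm_div, norm_pow, Padic.norm_p, div_le_one (by positivity)] at h
    rwa [zpow_neg, zpow_natCast, ← inv_pow]
  obtain ⟨k, rfl⟩ := (Padic.norm_int_le_pow_iff_dvd m n).mp h1
  refine ⟨k, ?_⟩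
  push_cast
  field_simp

theorem isPadicFraction_sub {r s : ℚ} (hr : ∃ (m : ℤ) (n : ℕ), r = m / (q : ℚ) ^ n)
    (hs : ∃ (m : ℤ) (n : ℕ), s = m / (q : ℚ) ^ n) :
    ∃ (m : ℤ) (n : ℕ), r - s = m / (q : ℚ) ^ n := by
  obtain ⟨m, n, rfl⟩ := hr
  obtain ⟨m', n', rfl⟩ := hs
  have hq : (q : ℚ) ≠ 0 := by exact_mod_cast (Fact.out : q.Prime).ne_zero
  refine ⟨m * q ^ n' - q ^ n * m', n + n', ?_⟩
  rw [div_sub_div _ _ (pow_ne_zero _ hq) (pow_ne_zero _ hq), pow_add]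
  push_cast
  rfl

/-- Independence of the representative chosen in `fracPart`: two of them differ by an element of
`ℤ[1/q] ∩ ℤ_q = ℤ`, which the exponential kills. -/
theorem psi_eq_exp {x : ℚ_[q]} {r : ℚ} (hr : ∃ (m : ℤ) (n : ℕ), r = m / (q : ℚ) ^ n)
    (h : ‖x - (r : ℚ_[q])‖ ≤ 1) :
    psi x = Complex.exp (-2 * Real.pi * Complex.I * (r : ℂ)) := by
  obtain ⟨h1, h2⟩ := (exists_fracPart x).choose_spec
  obtain ⟨k, hk⟩ := exists_int_of_norm_le_one (isPadicFraction_sub h1 hr) (by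
    rw [show (((exists_fracPart x).choose - r : ℚ) : ℚ_[q]) =
      (x - (r : ℚ_[q])) - (x - ((exists_fracPart x).choose : ℚ_[q])) by push_cast; ring]
    exact (norm_sub_le_max' _ _).trans (max_le h h2))
  rw [psi, fracPart, eq_add_of_sub_eq hk, Complex.exp_eq_exp_iff_exists_int]
  refine ⟨-k, ?_⟩
  push_cast
  ring

theorem psi_add (x y : ℚ_[q]) : psi (x + y) = psi x * psi y := by
  obtain ⟨r, hr, hx⟩ := exists_fracPart x
  obtain ⟨s, hs, hy⟩ := exists_fracPart y
  have hneg : ∃ (m : ℤ) (n : ℕ), -s = m / (q : ℚ) ^ n := by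
    obtain ⟨m, n, rfl⟩ := hs
    exact ⟨-m, n, by push_cast; ring⟩
  have hsum : ∃ (m : ℤ) (n : ℕ), r + s = m / (q : ℚ) ^ n := by
    simpa using isPadicFraction_sub hr hneg
  rw [psi_eq_exp hr hx, psi_eq_exp hs hy, psi_eq_exp hsum, ← Complex.exp_add]
  · push_cast
    ring_nf
  · rw [show x + y - ((r + s : ℚ) : ℚ_[q]) = (x - r) + (y - s) by push_cast; ring]
    exact (IsUltrametricDist.norm_add_le_max _ _).trans (max_le hx hy)

theorem psi_eq_one_iff {x : ℚ_[q]} : psi x = 1 ↔ ‖x‖ ≤ 1 := by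
  constructor
  · intro h
    obtain ⟨r, hr, hx⟩ := exists_fracPart x
    rw [psi_eq_exp hr hx, Complex.exp_eq_one_iff] at h
    obtain ⟨n, hn⟩ := h
    have h1 : (r : ℂ) = ((-n : ℤ) : ℂ) := by
      have : (2 * Real.pi * Complex.I : ℂ) ≠ 0 := Complex.two_pi_I_ne_zero
      apply mul_left_cancel₀ this
      push_cast
      linear_combination -hn
    have h2 : r = ((-n : ℤ) : ℚ) := by exact_mod_cast h1
    rw [← sub_add_cancel x (r : ℚ_[q])]
    refine (IsUltrametricDist.norm_add_le_max _ _).trans (max_le hx ?_)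
    rw [h2, Rat.cast_intCast]
    exact Padic.norm_int_le_one _
  · intro h
    rw [psi_eq_exp (r := 0) ⟨0, 0, by simp⟩ (by simpa using h)]
    simp

@[simp] theorem psi_zero : psi (0 : ℚ_[q]) = 1 := psi_eq_one_iff.mpr (by simp)

theorem norm_psi (x : ℚ_[q]) : ‖psi x‖ = 1 := by
  rw [psi, Complex.norm_exp]
  simp

theorem psi_natCast_mul (n : ℕ) (x : ℚ_[q]) : psi ((n : ℚ_[q]) * x) = psi x ^ n := by
  induction n with
  | zero => simp
  | succ n ih => rw [Nat.cast_succ, add_mul, one_mul, psi_add, ih, pow_succ]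

theorem psi_eq_psi_of_norm_sub_le_one {x y : ℚ_[q]} (h : ‖x - y‖ ≤ 1) : psi x = psi y := by
  rw [← sub_add_cancel x y, psi_add, psi_eq_one_iff.mpr h, one_mul]

theorem continuous_psi : Continuous (psi : ℚ_[q] → ℂ) := by
  rw [continuous_iff_continuousAt]
  intro x
  refine continuousAt_const.congr (f := fun _ => psi x) ?_
  filter_upwards [Metric.closedBall_mem_nhds x one_pos] with y hy
  rw [Metric.mem_closedBall, dist_eq_norm] at hy
  exact (psi_eq_psi_of_norm_sub_le_one hy).symm

theorem toZMod_eq_toZMod_iff {z w : ℤ_[q]} :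
    PadicInt.toZMod z = PadicInt.toZMod w ↔ ‖z - w‖ < 1 := by
  rw [← sub_eq_zero, ← map_sub, ← RingHom.mem_ker, PadicInt.ker_toZMod,
    IsLocalRing.mem_maximalIdeal, PadicInt.mem_nonunits]

theorem norm_eq_one_iff_toZMod_ne_zero {z : ℤ_[q]} : ‖z‖ = 1 ↔ PadicInt.toZMod z ≠ 0 := by
  rw [← map_zero (PadicInt.toZMod (p := q)), Ne, toZMod_eq_toZMod_iff, sub_zero, not_lt]
  exact ⟨fun h => h.ge, fun h => le_antisymm z.2 h⟩

theorem norm_lt_one_iff_le_inv {x : ℚ_[q]} : ‖x‖ < 1 ↔ ‖x‖ ≤ (q : ℝ)⁻¹ := by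
  have := Padic.norm_le_pow_iff_norm_lt_pow_add_one x (-1)
  simpa using this.symm

/-- This turns `q`-adic integrals into sums over `ZMod q`. The minus sign is the one in `ψ_q(x) =
e^{-2πi{x}}`. -/
theorem psi_div_prime (z : ℤ_[q]) :
    psi ((z : ℚ_[q]) / (q : ℚ_[q])) = ZMod.stdAddChar (-(PadicInt.toZMod z)) := by
  set n : ℕ := (PadicInt.toZMod z).val with hn
  have hz : ‖z - (n : ℤ_[q])‖ < 1 := by
    rw [← toZMod_eq_toZMod_iff, map_natCast, hn, ZMod.natCast_zmod_val]
  have hq := natCast_prime_ne_zero (q := q)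
  rw [psi_eq_exp (r := ((n : ℤ) : ℚ) / (q : ℚ) ^ 1) ⟨_, _, rfl⟩]
  · have := ZMod.stdAddChar_coe (N := q) (-(n : ℤ))
    push_cast at this
    rw [hn, ZMod.natCast_zmod_val, ← hn] at this
    rw [this]
    congr 1
    push_cast
    ring
  · have h2 : ‖(z : ℚ_[q]) - n‖ ≤ (q : ℝ)⁻¹ := by
      rw [← norm_lt_one_iff_le_inv]
      exact_mod_cast hz
    push_cast
    rw [pow_one, ← sub_div, norm_div, Padic.norm_p]
    exact div_le_one_of_le₀ h2 (by positivity)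

end AdditiveCharacter

/-! ### Integration on `ℚ_q` -/

section Integration

variable {q : ℕ} [Fact q.Prime]

instance : (haarQ q).IsAddHaarMeasure := by unfold haarQ; infer_instance

theorem haarQ_closedBall_one : haarQ q (Metric.closedBall 0 1) = 1 :=
  Measure.addHaarMeasure_self (K₀ := integerBall q)

theorem closedBall_eq_iUnion :
    Metric.closedBall (0 : ℚ_[q]) 1 =
      ⋃ a : ZMod q, Metric.closedBall ((a.val : ℕ) : ℚ_[q]) (q : ℝ)⁻¹ := by
  ext x
  simp only [Metric.mem_closedBall, Set.mem_iUnion, dist_eq_norm, sub_zero]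
  constructor
  · intro hx
    obtain ⟨z, rfl⟩ := exists_padicInt_coe_eq hx
    refine ⟨PadicInt.toZMod z, ?_⟩
    rw [← norm_lt_one_iff_le_inv]
    have : ‖z - (((PadicInt.toZMod z).val : ℕ) : ℤ_[q])‖ < 1 := by
      rw [← toZMod_eq_toZMod_iff, map_natCast, ZMod.natCast_zmod_val]
    exact_mod_cast this
  · rintro ⟨a, ha⟩
    rw [← sub_add_cancel x (a.val : ℚ_[q])]
    refine (IsUltrametricDist.norm_add_le_max _ _).trans
      (max_le (norm_lt_one_iff_le_inv.mpr ha).le ?_)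
    exact_mod_cast Padic.norm_int_le_one (p := q) (a.val : ℤ)

theorem toZMod_eq_of_mem_closedBall {a : ZMod q} {x : ℚ_[q]}
    (hx : x ∈ Metric.closedBall ((a.val : ℕ) : ℚ_[q]) (q : ℝ)⁻¹) :
    ∃ z : ℤ_[q], (z : ℚ_[q]) = x ∧ PadicInt.toZMod z = a := by
  have h1 : x ∈ Metric.closedBall (0 : ℚ_[q]) 1 := by
    rw [closedBall_eq_iUnion]
    exact Set.mem_iUnion.mpr ⟨a, hx⟩
  rw [Metric.mem_closedBall, dist_zero_right] at h1
  obtain ⟨z, rfl⟩ := exists_padicInt_coe_eq h1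
  refine ⟨z, rfl, ?_⟩
  rw [Metric.mem_closedBall, dist_eq_norm, ← norm_lt_one_iff_le_inv] at hx
  have h2 : PadicInt.toZMod z = PadicInt.toZMod ((a.val : ℕ) : ℤ_[q]) := by
    rw [toZMod_eq_toZMod_iff]
    exact_mod_cast hx
  rw [h2, map_natCast, ZMod.natCast_zmod_val]

theorem pairwise_disjoint_closedBall :
    Pairwise (Function.onFun Disjoint
      fun a : ZMod q => Metric.closedBall ((a.val : ℕ) : ℚ_[q]) (q : ℝ)⁻¹) := by
  intro a b hab
  rw [Function.onFun, Set.disjoint_left]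
  intro x hxa hxb
  obtain ⟨z, hz, hza⟩ := toZMod_eq_of_mem_closedBall hxa
  obtain ⟨w, hw, hwb⟩ := toZMod_eq_of_mem_closedBall hxb
  have : z = w := Subtype.ext (hz.trans hw.symm)
  exact hab (by rw [← hza, ← hwb, this])

theorem haarQ_closedBall_inv (a : ℚ_[q]) :
    haarQ q (Metric.closedBall a (q : ℝ)⁻¹) = (q : ENNReal)⁻¹ := by
  have htr : ∀ b : ℚ_[q], haarQ q (Metric.closedBall b (q : ℝ)⁻¹) =
      haarQ q (Metric.closedBall 0 (q : ℝ)⁻¹) := fun b => by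
    rw [← measure_preimage_add_right (haarQ q) b (Metric.closedBall b _)]
    congr 1
    ext x
    simp [dist_eq_norm]
  have h1 := haarQ_closedBall_one (q := q)
  rw [closedBall_eq_iUnion, measure_iUnion pairwise_disjoint_closedBall
    fun _ => Metric.isClosed_closedBall.measurableSet, tsum_fintype] at h1
  simp only [htr] at h1
  rw [Finset.sum_const, Finset.card_univ, ZMod.card, nsmul_eq_mul] at h1
  rw [htr, ← ENNReal.eq_inv_of_mul_eq_one_left ((mul_comm _ _).trans h1)]

theorem setIntegral_closedBall_eq_sum (f : ℚ_[q] → ℂ) (g : ZMod q → ℂ)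
    (h : ∀ z : ℤ_[q], f z = g (PadicInt.toZMod z)) :
    ∫ x in Metric.closedBall 0 1, f x ∂(haarQ q) = (q : ℂ)⁻¹ * ∑ a, g a := by
  have hf : ∀ a : ZMod q, Set.EqOn f (fun _ => g a)
      (Metric.closedBall ((a.val : ℕ) : ℚ_[q]) (q : ℝ)⁻¹) := by
    intro a x hx
    obtain ⟨z, rfl, rfl⟩ := toZMod_eq_of_mem_closedBall hx
    exact h z
  have hm : ∀ a : ZMod q, MeasurableSet (Metric.closedBall ((a.val : ℕ) : ℚ_[q]) (q : ℝ)⁻¹) :=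
    fun _ => Metric.isClosed_closedBall.measurableSet
  rw [closedBall_eq_iUnion, integral_iUnion_fintype hm pairwise_disjoint_closedBall, Finset.mul_sum]
  · refine Finset.sum_congr rfl fun a _ => ?_
    rw [setIntegral_congr_fun (hm a) (hf a), setIntegral_const, Measure.real,
      haarQ_closedBall_inv]
    simp
  · intro a
    refine IntegrableOn.congr_fun ?_ (hf a).symm (hm a)
    exact integrableOn_const (by rw [haarQ_closedBall_inv]; simp [(Fact.out : q.Prime).ne_zero])

theorem setIntegral_closedBall_add_right (f : ℚ_[q] → ℂ) {y : ℚ_[q]} (hy : ‖y‖ ≤ 1) :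
    ∫ x in Metric.closedBall 0 1, f (x + y) ∂(haarQ q) =
      ∫ x in Metric.closedBall 0 1, f x ∂(haarQ q) := by
  have hm : MeasurableSet (Metric.closedBall (0 : ℚ_[q]) 1) :=
    Metric.isClosed_closedBall.measurableSet
  rw [← integral_indicator hm, ← integral_indicator hm,
    ← integral_add_right_eq_self ((Metric.closedBall 0 1).indicator f) y]
  congr 1
  ext x
  have : x + y ∈ Metric.closedBall (0 : ℚ_[q]) 1 ↔ x ∈ Metric.closedBall (0 : ℚ_[q]) 1 := by
    simp only [Metric.mem_closedBall, dist_zero_right]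
    constructor
    · intro h
      rw [← add_sub_cancel_right x y]
      exact (norm_sub_le_max' _ _).trans (max_le h hy)
    · intro h
      exact (IsUltrametricDist.norm_add_le_max _ _).trans (max_le h hy)
  by_cases hx : x ∈ Metric.closedBall (0 : ℚ_[q]) 1
  · rw [Set.indicator_of_mem hx, Set.indicator_of_mem (this.mpr hx)]
  · rw [Set.indicator_of_notMem hx, Set.indicator_of_notMem (mt this.mp hx)]

/-- The pushforward of Haar measure under multiplication by `q` is a multiple of Haar measure. The
ball of radius `q⁻¹`, whose preimage is `ℤ_q`, shows the factor to be `q`. -/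
theorem integral_comp_prime_mul (f : ℚ_[q] → ℂ) :
    ∫ x, f (q * x) ∂(haarQ q) = q * ∫ x, f x ∂(haarQ q) := by
  have hq := natCast_prime_ne_zero (q := q)
  have hqr : (0 : ℝ) < q := by exact_mod_cast (Fact.out : q.Prime).pos
  let e : ℚ_[q] ≃ₜ ℚ_[q] := Homeomorph.mulLeft₀ (q : ℚ_[q]) hq
  have hemb : MeasurableEmbedding e := e.measurableEmbedding
  let e' : ℚ_[q] ≃+ ℚ_[q] := { e.toEquiv with map_add' := fun x y => mul_add _ x y }
  have : (Measure.map e (haarQ q)).IsAddHaarMeasure :=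
    e'.isAddHaarMeasure_map (haarQ q) e.continuous e.symm.continuous
  have h1 : Measure.map e (haarQ q) = (q : ENNReal) • haarQ q := by
    have hc : Measure.map e (haarQ q) = _ • haarQ q :=
      Measure.addHaarMeasure_unique (Measure.map e (haarQ q)) (integerBall q)
    set c := Measure.map e (haarQ q) (integerBall q)
    have h2 : Measure.map e (haarQ q) (Metric.closedBall 0 (q : ℝ)⁻¹) = 1 := by
      rw [hemb.map_apply, ← haarQ_closedBall_one (q := q)]
      congr 1
      ext x
      have : e x = q * x := rfl
      simp only [Set.mem_preimage, Metric.mem_closedBall, dist_zero_right, this, norm_mul,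
        Padic.norm_p]
      exact mul_le_iff_le_one_right (inv_pos.mpr hqr)
    rw [hc, Measure.smul_apply, haarQ_closedBall_inv, smul_eq_mul] at h2
    rw [hc, ENNReal.eq_inv_of_mul_eq_one_left h2, inv_inv]
  have h3 := hemb.integral_map (μ := haarQ q) f
  rw [h1, integral_smul_measure] at h3
  exact h3.symm.trans (by simp)

theorem integral_comp_prime_pow_mul (k : ℕ) (f : ℚ_[q] → ℂ) :
    ∫ x, f ((q : ℚ_[q]) ^ k * x) ∂(haarQ q) = (q : ℂ) ^ k * ∫ x, f x ∂(haarQ q) := by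
  induction k generalizing f with
  | zero => simp
  | succ k ih =>
    simp_rw [pow_succ, mul_assoc]
    rw [integral_comp_prime_mul fun x => f ((q : ℚ_[q]) ^ k * x), ih]
    ring

end Integration

/-! ### Local Gauss integrals -/

section GaussIntegral

theorem sum_quadraticChar_mul_stdAddChar (p : ℕ) [Fact p.Prime] (hp : p % 4 = 3) {c : ZMod p}
    (hc : c ≠ 0) :
    ∑ y : ZMod p, ((quadraticChar (ZMod p) y : ℤ) : ℂ) * ZMod.stdAddChar (c * y) =
      ((quadraticChar (ZMod p) c : ℤ) : ℂ) * (Complex.I * (Real.sqrt p : ℝ)) := by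
  rw [← gaussSum_quadraticChar_stdAddChar p hp]
  have h4 := gaussSum_mulShift_eq ((quadraticChar (ZMod p)).ringHomComp (Int.castRingHom ℂ))
    ZMod.stdAddChar (Units.mk0 c hc)
  rw [((quadraticChar_isQuadratic (ZMod p)).comp _).inv] at h4
  exact h4

/-- Grouping by `y = a²`, each `y` has `1 + (y/p)` square roots; the constant part sums to zero and
the rest is the Gauss sum. -/
theorem sum_stdAddChar_mul_sq (p : ℕ) [Fact p.Prime] (hp : p % 4 = 3) {c : ZMod p} (hc : c ≠ 0) :
    ∑ a : ZMod p, ZMod.stdAddChar (c * a ^ 2) =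
      ((quadraticChar (ZMod p) c : ℤ) : ℂ) * (Complex.I * (Real.sqrt p : ℝ)) := by
  have hchar : ringChar (ZMod p) ≠ 2 := by rw [ZMod.ringChar_zmod_n]; omega
  have h1 : ∑ a : ZMod p, ZMod.stdAddChar (c * a ^ 2) =
      ∑ y : ZMod p, (1 + ((quadraticChar (ZMod p) y : ℤ) : ℂ)) * ZMod.stdAddChar (c * y) := by
    rw [← Finset.sum_fiberwise (s := Finset.univ) (g := fun a : ZMod p => a ^ 2)]
    refine Finset.sum_congr rfl fun y _ => ?_
    rw [Finset.sum_congr rfl (g := fun _ => ZMod.stdAddChar (c * y)) fun a ha => by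
      rw [(Finset.mem_filter.mp ha).2], Finset.sum_const, nsmul_eq_mul]
    congr 1
    have h2 := quadraticChar_card_sqrts hchar y
    rw [Set.toFinset_ofPred] at h2
    rw [add_comm]
    exact_mod_cast h2
  rw [h1]
  simp_rw [add_mul, one_mul]
  rw [Finset.sum_add_distrib]
  have h3 : ∑ y : ZMod p, ZMod.stdAddChar (c * y) = (0 : ℂ) := by
    have := AddChar.sum_mulShift c (ZMod.isPrimitive_stdAddChar p)
    rw [if_neg hc, Nat.cast_zero] at this
    rw [← this]
    exact Finset.sum_congr rfl fun y _ => by rw [mul_comm]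
  rw [h3, zero_add, sum_quadraticChar_mul_stdAddChar p hp hc]

variable {q : ℕ} [Fact q.Prime]

/-- The Gauss integral `∫ ψ (b x²) dx` over `ℤ_q`. -/
def gaussIntegral (b : ℚ_[q]) : ℂ :=
  ∫ x in Metric.closedBall 0 1, psi (b * x ^ 2) ∂(haarQ q)

theorem gaussIntegral_of_norm_le_one {b : ℚ_[q]} (hb : ‖b‖ ≤ 1) : gaussIntegral b = 1 := by
  rw [gaussIntegral, setIntegral_congr_fun (g := fun _ => (1 : ℂ))
    Metric.isClosed_closedBall.measurableSet]
  · simp [Measure.real, haarQ_closedBall_one]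
  · intro x hx
    rw [Metric.mem_closedBall, dist_zero_right] at hx
    refine psi_eq_one_iff.mpr ?_
    rw [norm_mul, norm_pow]
    exact mul_le_one₀ hb (by positivity) (pow_le_one₀ (norm_nonneg _) hx)

theorem gaussIntegral_div_prime (hq : q % 4 = 3) {z : ℤ_[q]} (hz : ‖z‖ = 1) :
    gaussIntegral ((z : ℚ_[q]) / (q : ℚ_[q])) =
      (q : ℂ)⁻¹ * ((quadraticChar (ZMod q) (-PadicInt.toZMod z) : ℤ) : ℂ) *
        (Complex.I * (Real.sqrt q : ℝ)) := by
  rw [norm_eq_one_iff_toZMod_ne_zero] at hz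
  rw [mul_assoc, ← sum_stdAddChar_mul_sq q hq (neg_ne_zero.mpr hz), gaussIntegral]
  refine setIntegral_closedBall_eq_sum _ (fun a => ZMod.stdAddChar (-PadicInt.toZMod z * a ^ 2)) ?_
  intro x
  rw [show (z : ℚ_[q]) / q * (x : ℚ_[q]) ^ 2 = ((z * x ^ 2 : ℤ_[q]) : ℚ_[q]) / q by
    push_cast; ring, psi_div_prime]
  simp

theorem norm_two_padic (hq : q ≠ 2) : ‖(2 : ℚ_[q])‖ = 1 := by
  have h := (Padic.norm_natCast_eq_one_iff (p := q) (n := 2)).mpr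
    ((Nat.coprime_primes Fact.out Nat.prime_two).mpr hq)
  exact_mod_cast h

theorem sum_psi_pow (x : ℚ_[q]) (hx : ‖x‖ ≤ q) :
    ∑ y ∈ Finset.range q, psi x ^ y = if ‖x‖ ≤ 1 then (q : ℂ) else 0 := by
  split_ifs with h
  · simp [psi_eq_one_iff.mpr h]
  · have h1 : psi x ≠ 1 := mt psi_eq_one_iff.mp h
    have h2 : psi x ^ q = 1 := by
      rw [← psi_natCast_mul, psi_eq_one_iff, norm_mul, Padic.norm_p]
      exact inv_mul_le_one_of_le₀ hx (by positivity)
    rw [geom_sum_eq h1, h2, sub_self, zero_div]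

/-- Average over the translates `x ↦ x + c y`, `0 ≤ y < q`. Since `b c²` is integral, `b(x + cy)² ≡
b x² + 2bcxy` modulo `ℤ_q`. As `|2bcx| = q|x|`, the sum over `y` is a full character sum that kills
`|x| = 1` and leaves `x ∈ qℤ_q`, where `x = q x'` replaces `b` by `b q²`. -/
theorem gaussIntegral_eq_inv_mul (hq : q ≠ 2) {b c : ℚ_[q]} (hc : ‖c‖ ≤ 1)
    (hbc2 : ‖b * c ^ 2‖ ≤ 1) (hbc : ‖b * c‖ = q) :
    gaussIntegral b = (q : ℂ)⁻¹ * gaussIntegral (b * (q : ℚ_[q]) ^ 2) := by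
  have hq0 : (q : ℂ) ≠ 0 := by exact_mod_cast (Fact.out : q.Prime).ne_zero
  have hqr : (0 : ℝ) < q := by exact_mod_cast (Fact.out : q.Prime).pos
  have hm : MeasurableSet (Metric.closedBall (0 : ℚ_[q]) 1) :=
    Metric.isClosed_closedBall.measurableSet
  have h1 : (q : ℂ) * gaussIntegral b = ∑ y ∈ Finset.range q,
      ∫ x in Metric.closedBall 0 1, psi (b * (x + c * (y : ℚ_[q])) ^ 2) ∂(haarQ q) := by
    rw [Finset.sum_congr rfl (g := fun _ => gaussIntegral b), Finset.sum_const, Finset.card_range,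
      nsmul_eq_mul]
    intro y _
    refine setIntegral_closedBall_add_right (fun x => psi (b * x ^ 2)) ?_
    rw [norm_mul]
    refine mul_le_one₀ hc (norm_nonneg _) ?_
    exact_mod_cast Padic.norm_int_le_one (p := q) (y : ℤ)
  have h2 : (q : ℂ) * gaussIntegral b = ∫ x in Metric.closedBall 0 1,
      (if ‖x‖ ≤ (q : ℝ)⁻¹ then (q : ℂ) else 0) * psi (b * x ^ 2) ∂(haarQ q) := by
    rw [h1, ← integral_finsetSum]
    · refine setIntegral_congr_fun hm fun x hx => ?_
      rw [Metric.mem_closedBall, dist_zero_right] at hx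
      have h3 : ‖2 * (b * c) * x‖ = q * ‖x‖ := by
        rw [norm_mul, norm_mul, norm_two_padic hq, hbc, one_mul]
      have h4 := sum_psi_pow (2 * (b * c) * x) (by
        rw [h3]; exact mul_le_of_le_one_right (by positivity) hx)
      have h5 : (‖2 * (b * c) * x‖ ≤ 1) = (‖x‖ ≤ (q : ℝ)⁻¹) := by
        rw [h3, ← le_div_iff₀' hqr, one_div]
      simp only [h5] at h4
      rw [← h4, Finset.sum_mul]
      refine Finset.sum_congr rfl fun y _ => ?_
      rw [← psi_natCast_mul, ← psi_add]
      refine psi_eq_psi_of_norm_sub_le_one ?_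
      rw [show b * (x + c * y) ^ 2 - ((y : ℚ_[q]) * (2 * (b * c) * x) + b * x ^ 2) =
        b * c ^ 2 * (y : ℚ_[q]) ^ 2 by ring, norm_mul, norm_pow]
      refine mul_le_one₀ hbc2 (by positivity) (pow_le_one₀ (norm_nonneg _) ?_)
      exact_mod_cast Padic.norm_int_le_one (p := q) (y : ℤ)
    · intro y _
      refine ContinuousOn.integrableOn_compact (isCompact_closedBall _ _) ?_
      exact (continuous_psi.comp (by fun_prop)).continuousOn
  have h6 : ∫ x in Metric.closedBall 0 1,
      (if ‖x‖ ≤ (q : ℝ)⁻¹ then (q : ℂ) else 0) * psi (b * x ^ 2) ∂(haarQ q) =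
      gaussIntegral (b * (q : ℚ_[q]) ^ 2) := by
    classical
    apply mul_left_cancel₀ hq0
    rw [gaussIntegral, ← integral_indicator hm, ← integral_indicator hm, ← integral_comp_prime_mul,
      ← integral_const_mul]
    congr 1
    ext x
    have hx : (‖(q : ℚ_[q]) * x‖ ≤ (q : ℝ)⁻¹) ↔ ‖x‖ ≤ 1 := by
      rw [norm_mul, Padic.norm_p]
      exact mul_le_iff_le_one_right (inv_pos.mpr hqr)
    have hle : (q : ℝ)⁻¹ ≤ 1 := inv_le_one_of_one_le₀ (by
      exact_mod_cast (Fact.out : q.Prime).one_le)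
    rw [Set.indicator_apply, Set.indicator_apply, Metric.mem_closedBall, Metric.mem_closedBall,
      dist_zero_right, dist_zero_right]
    by_cases h : ‖x‖ ≤ 1
    · rw [if_pos ((hx.mpr h).trans hle), if_pos (hx.mpr h), if_pos h]
      congr 2
      ring
    · rw [if_neg h, mul_zero]
      rw [if_neg (mt hx.mp h), zero_mul, ite_self]
  rw [eq_inv_mul_iff_mul_eq₀ hq0, h2, h6]

/-- The integral of `ψ (-b (x² + q y²))` over `ℤ_q × ℤ_q`. -/
def normIntegral (b : ℚ_[q]) : ℂ := gaussIntegral (-b) * gaussIntegral (-b * (q : ℚ_[q]))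

theorem normIntegral_of_norm_le_one {b : ℚ_[q]} (hb : ‖b‖ ≤ 1) : normIntegral b = 1 := by
  rw [normIntegral, gaussIntegral_of_norm_le_one (by rwa [norm_neg]),
    gaussIntegral_of_norm_le_one, one_mul]
  rw [norm_mul, norm_neg]
  exact mul_le_one₀ hb (norm_nonneg _) Padic.norm_p_lt_one.le

/-- For `k = 0` one factor is trivial and the other is a Gauss sum. Replacing `b` by `b/q` exchanges
the roles of the two factors up to one reduction `b ↦ b q²`, at the cost of `q⁻¹`; this avoids any
case distinction on the parity of the exponent. -/
theorem normIntegral_div_prime_pow (hq : q % 4 = 3) {z : ℤ_[q]} (hz : ‖z‖ = 1) (k : ℕ) :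
    normIntegral ((z : ℚ_[q]) / (q : ℚ_[q]) ^ (k + 1)) = ((q : ℂ) ^ (k + 1))⁻¹ *
      ((quadraticChar (ZMod q) (PadicInt.toZMod z) : ℤ) : ℂ) *
        (Complex.I * (Real.sqrt q : ℝ)) := by
  have hq0 : (q : ℂ) ≠ 0 := by exact_mod_cast (Fact.out : q.Prime).ne_zero
  have hqp := natCast_prime_ne_zero (q := q)
  have hqr : (0 : ℝ) < q := by exact_mod_cast (Fact.out : q.Prime).pos
  have hz' : ‖(z : ℚ_[q])‖ = 1 := hz
  induction k with
  | zero =>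
    rw [normIntegral, zero_add, pow_one, pow_one, neg_mul, div_mul_cancel₀ _ hqp,
      gaussIntegral_of_norm_le_one (b := -(z : ℚ_[q])) (by rw [norm_neg, hz']), mul_one]
    have := gaussIntegral_div_prime hq (z := -z) (by rwa [norm_neg])
    rw [map_neg PadicInt.toZMod, neg_neg] at this
    rw [← this]
    congr 1
    push_cast
    ring
  | succ k ih =>
    -- With `c = q^(k+1)` one has `|bc| = q` and `|bc²| = q^{-k} ≤ 1`, as the reduction requires.
    have h1 := gaussIntegral_eq_inv_mul (q := q) (by omega) (b := -((z : ℚ_[q]) / q ^ (k + 1 + 1)))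
      (c := q ^ (k + 1)) ?_ ?_ ?_
    · have h2 : normIntegral ((z : ℚ_[q]) / (q : ℚ_[q]) ^ (k + 1 + 1)) =
          (q : ℂ)⁻¹ * normIntegral ((z : ℚ_[q]) / (q : ℚ_[q]) ^ (k + 1)) := by
        have e1 : -((z : ℚ_[q]) / (q : ℚ_[q]) ^ (k + 1 + 1)) * (q : ℚ_[q]) =
            -((z : ℚ_[q]) / (q : ℚ_[q]) ^ (k + 1)) := by
          field_simp
          ring
        have e2 : -((z : ℚ_[q]) / (q : ℚ_[q]) ^ (k + 1 + 1)) * (q : ℚ_[q]) ^ 2 =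
            -((z : ℚ_[q]) / (q : ℚ_[q]) ^ (k + 1)) * q := by
          field_simp
          ring
        rw [normIntegral, normIntegral, h1, e1, e2]
        ring
      rw [h2, ih, pow_succ _ (k + 1), mul_inv_rev]
      ring
    · rw [norm_pow]
      exact pow_le_one₀ (norm_nonneg _) Padic.norm_p_lt_one.le
    · rw [show -((z : ℚ_[q]) / q ^ (k + 1 + 1)) * (q ^ (k + 1)) ^ 2 = -z * (q : ℚ_[q]) ^ k by
        field_simp; ring, norm_mul, norm_neg, hz', one_mul, norm_pow]
      exact pow_le_one₀ (norm_nonneg _) Padic.norm_p_lt_one.le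
    · rw [show -((z : ℚ_[q]) / q ^ (k + 1 + 1)) * (q ^ (k + 1)) = -z / (q : ℚ_[q]) by
        field_simp; ring, norm_div, norm_neg, hz', Padic.norm_p, one_div, inv_inv]

end GaussIntegral

/-! ### The quadratic character `χ_q` -/

section QuadraticCharacter

variable {q : ℕ} [Fact q.Prime]

/-- Hensel's lemma for `X² - u`: at a unit approximation `a` the derivative `2a` is a unit, as `q`
is odd. -/
theorem isSquare_of_isSquare_toZMod (hq : q ≠ 2) {u : ℤ_[q]} (hu : ‖u‖ = 1)
    (h : IsSquare (PadicInt.toZMod u)) : IsSquare u := by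
  obtain ⟨r, hr⟩ := h
  have hlift : PadicInt.toZMod ((r.val : ℕ) : ℤ_[q]) = r := by
    rw [map_natCast, ZMod.natCast_zmod_val]
  set a : ℤ_[q] := ((r.val : ℕ) : ℤ_[q])
  have h1 : ‖a ^ 2 - u‖ < 1 := by
    rw [← toZMod_eq_toZMod_iff, map_pow, hlift, hr, sq]
  have ha : ‖a‖ = 1 := by
    rw [norm_eq_one_iff_toZMod_ne_zero] at hu ⊢
    rw [hlift]
    rintro rfl
    exact hu (by rw [hr, mul_zero])
  have h2 : ‖(2 : ℤ_[q])‖ = 1 := norm_two_padic hq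
  obtain ⟨z, hz, -⟩ := hensels_lemma (p := q) (F := (Polynomial.X ^ 2 - Polynomial.C u)) (a := a) (by
    simpa [ha, h2, one_add_one_eq_two] using h1)
  refine ⟨z, ?_⟩
  have h3 : z ^ 2 - u = 0 := by simpa using hz
  rw [← sq, sub_eq_zero.mp h3]

/-- The left side has even valuation, the right side odd. -/
theorem norm_sq_ne_norm_prime_mul_sq {α β : ℚ_[q]} (hβ : β ≠ 0) :
    ‖α ^ 2‖ ≠ ‖(q : ℚ_[q]) * β ^ 2‖ := by
  intro h
  have hα : α ≠ 0 := by
    rintro rfl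
    have := norm_eq_zero.mp (h.symm.trans (by simp))
    simp [hβ, (Fact.out : q.Prime).ne_zero] at this
  have h1 : (α ^ 2).valuation = ((q : ℚ_[q]) * β ^ 2).valuation := by
    rw [Padic.norm_eq_zpow_neg_valuation (pow_ne_zero _ hα), Padic.norm_eq_zpow_neg_valuation
      (mul_ne_zero natCast_prime_ne_zero (pow_ne_zero _ hβ))] at h
    have := zpow_right_injective₀ (by exact_mod_cast (Fact.out : q.Prime).pos)
      (by exact_mod_cast (Fact.out : q.Prime).one_lt.ne') h
    exact neg_injective this
  rw [Padic.valuation_mul natCast_prime_ne_zero (pow_ne_zero _ hβ), Padic.valuation_pow,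
    Padic.valuation_pow, Padic.valuation_p] at h1
  push_cast at h1
  omega

theorem norm_le_one_of_prime_mul_sq {β : ℚ_[q]} (h : ‖(q : ℚ_[q]) * β ^ 2‖ ≤ 1) : ‖β‖ ≤ 1 := by
  have hq1 : (1 : ℝ) < q := by exact_mod_cast (Fact.out : q.Prime).one_lt
  by_contra hlt
  have h1 : (q : ℝ) ≤ ‖β‖ := by
    have := Padic.norm_le_pow_iff_norm_lt_pow_add_one β 0
    simpa [hlt] using this
  rw [norm_mul, norm_pow, Padic.norm_p, inv_mul_le_one₀ (by linarith)] at h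
  nlinarith

/-- The two terms have valuations of different parity, so nothing cancels and both are integral;
reduction modulo `q` then leaves only `α²`. -/
theorem isSquare_toZMod_of_eq_sq_add {u : ℤ_[q]} {α β : ℚ_[q]}
    (h : (u : ℚ_[q]) = α ^ 2 + q * β ^ 2) : IsSquare (PadicInt.toZMod u) := by
  have hq1 : (1 : ℝ) < q := by exact_mod_cast (Fact.out : q.Prime).one_lt
  have hu : ‖(u : ℚ_[q])‖ ≤ 1 := u.2
  have hqβ : ‖(q : ℚ_[q]) * β ^ 2‖ ≤ 1 := by
    by_contra hlt
    rw [not_le] at hlt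
    have hβ0 : β ≠ 0 := by
      rintro rfl
      simp at hlt
      linarith
    refine norm_sq_ne_norm_prime_mul_sq (α := α) hβ0 ?_
    have h1 : α ^ 2 = (u : ℚ_[q]) + -((q : ℚ_[q]) * β ^ 2) := by rw [h]; ring
    rw [h1, IsUltrametricDist.norm_add_eq_max_of_norm_ne_norm, norm_neg,
      max_eq_right (hu.trans hlt.le)]
    rw [norm_neg]
    exact (hu.trans_lt hlt).ne
  have hβ : ‖β‖ ≤ 1 := norm_le_one_of_prime_mul_sq hqβ
  have hα : ‖α‖ ≤ 1 := by
    have h1 : α ^ 2 = (u : ℚ_[q]) - (q : ℚ_[q]) * β ^ 2 := by rw [h]; ring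
    have h2 : ‖α ^ 2‖ ≤ 1 := by
      rw [h1]
      exact (norm_sub_le_max' _ _).trans (max_le hu hqβ)
    rw [norm_pow] at h2
    exact (pow_le_one_iff_of_nonneg (norm_nonneg _) two_ne_zero).mp h2
  obtain ⟨a, rfl⟩ := exists_padicInt_coe_eq hα
  obtain ⟨b, rfl⟩ := exists_padicInt_coe_eq hβ
  have h3 : u = a ^ 2 + q * b ^ 2 := by
    apply PadicInt.ext
    push_cast
    exact h
  refine ⟨PadicInt.toZMod a, ?_⟩
  rw [h3]
  simp [sq]

/-- Powers of `q` do not matter because `q` is a norm from `ℚ_q(√-q)`. In one direction a square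
root of `u` gives an explicit zero of the form; in the other, a zero with `X ≠ 0` writes `u` as `α²
+ q β²`, with the roles of `Y` and `Z` depending on the parity of `n`. -/
theorem chi_prime_pow_mul (hq : q ≠ 2) (n : ℕ) {u : ℤ_[q]} (hu : ‖u‖ = 1) :
    chi ((q : ℚ_[q]) ^ n * (u : ℚ_[q])) = quadraticChar (ZMod q) (PadicInt.toZMod u) := by
  have hq0 := natCast_prime_ne_zero (q := q)
  have hu0 : PadicInt.toZMod u ≠ 0 := norm_eq_one_iff_toZMod_ne_zero.mp hu
  by_cases hsq : IsSquare (PadicInt.toZMod u)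
  · rw [(quadraticChar_one_iff_isSquare hu0).mpr hsq, chi, hilbertSymbol, if_pos]
    obtain ⟨v, rfl⟩ := isSquare_of_isSquare_toZMod hq hu hsq
    rcases Nat.even_or_odd' n with ⟨c, rfl | rfl⟩
    · refine ⟨1, 0, (q : ℚ_[q]) ^ c * v, by simp, ?_⟩
      push_cast
      ring
    · refine ⟨1, (q : ℚ_[q]) ^ c * v, 0, by simp, ?_⟩
      push_cast
      ring
  · rw [quadraticChar_neg_one_iff_not_isSquare.mpr hsq, chi, hilbertSymbol, if_neg]
    rintro ⟨X, Y, Z, hne, h⟩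
    apply hsq
    -- If `X = 0` the equation is `Z² = -q Y²`, excluded by parity of valuations.
    by_cases hX : X = 0
    · exfalso
      subst hX
      have h1 : ‖Z ^ 2‖ = ‖(q : ℚ_[q]) * Y ^ 2‖ := by
        rw [h, ← norm_neg]
        congr 1
        ring
      have hY : Y = 0 := by
        by_contra hY
        exact norm_sq_ne_norm_prime_mul_sq hY h1
      subst hY
      simp at h
      simp [h] at hne
    · rcases Nat.even_or_odd' n with ⟨c, rfl | rfl⟩
      · refine isSquare_toZMod_of_eq_sq_add (α := Z / X / (q : ℚ_[q]) ^ c)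
          (β := Y / X / (q : ℚ_[q]) ^ c) ?_
        field_simp
        linear_combination -h
      · refine isSquare_toZMod_of_eq_sq_add (α := Y / X / (q : ℚ_[q]) ^ c)
          (β := Z / X / (q : ℚ_[q]) ^ (c + 1)) ?_
        field_simp
        linear_combination -(q : ℚ_[q]) ^ (2 * c + 1) * h

theorem chi_neg_one (hq : q % 4 = 3) : chi (-1 : ℚ_[q]) = -1 := by
  have h := chi_prime_pow_mul (q := q) (by omega) 0 (u := -1) (by simp)
  have h1 : (q : ℚ_[q]) ^ 0 * ((-1 : ℤ_[q]) : ℚ_[q]) = -1 := by simp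
  rw [h1] at h
  rw [h, quadraticChar_neg_one_iff_not_isSquare]
  simp [ZMod.exists_sq_eq_neg_one_iff, hq]

theorem localLFactor_eq_one (hq : q % 4 = 3) (s : ℂ) : localLFactor q s = 1 := by
  rw [localLFactor, if_neg]
  intro h
  have := h (-1)
  rw [show (((-1 : ℤ_[q]ˣ) : ℤ_[q]) : ℚ_[q]) = -1 by simp, chi_neg_one hq] at this
  norm_num at this

theorem exists_eq_prime_pow_mul (t : ℤ) (ht : t ≠ 0) :
    ∃ u : ℤ_[q], ‖u‖ = 1 ∧ (t : ℚ_[q]) = (q : ℚ_[q]) ^ padicValInt q t * (u : ℚ_[q]) := by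
  have hq := natCast_prime_ne_zero (q := q)
  have ht' : (t : ℚ_[q]) ≠ 0 := by exact_mod_cast ht
  have hn : ‖(t : ℚ_[q]) / (q : ℚ_[q]) ^ padicValInt q t‖ = 1 := by
    rw [norm_div, norm_pow, Padic.norm_p, Padic.norm_eq_zpow_neg_valuation ht',
      Padic.valuation_intCast, zpow_neg, zpow_natCast, inv_pow, div_self]
    have : (q : ℝ) ≠ 0 := by exact_mod_cast (Fact.out : q.Prime).ne_zero
    positivity
  obtain ⟨u, hu⟩ := exists_padicInt_coe_eq hn.le
  refine ⟨u, ?_, ?_⟩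
  · rw [← hn, ← hu]
    rfl
  · rw [hu, mul_div_cancel₀ _ (pow_ne_zero _ hq)]

end QuadraticCharacter

/-! ### Ideals of `q`-power norm -/

section Ideals

variable (q : ℕ) [Fact q.Prime]

/-- `√-q` is an algebraic integer of `ℚ(√-q)`. -/
theorem exists_sqrt_neg : ∃ δ : 𝓞 (kField q), δ ^ 2 = -(q : 𝓞 (kField q)) := by
  have h : (QuadraticAlgebra.omega : kField q) ^ 2 = -(q : kField q) := by
    ext <;> simp [sq]
  have hint : IsIntegral ℤ (QuadraticAlgebra.omega : kField q) := by
    refine IsIntegral.of_pow (n := 2) two_pos ?_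
    rw [h]
    exact (isIntegral_algebraMap (R := ℤ) (x := (q : ℤ))).neg
  obtain ⟨δ, hδ⟩ : ∃ δ : 𝓞 (kField q), algebraMap _ (kField q) δ = QuadraticAlgebra.omega :=
    ⟨⟨QuadraticAlgebra.omega, hint⟩, rfl⟩
  refine ⟨δ, FaithfulSMul.algebraMap_injective (𝓞 (kField q)) (kField q) ?_⟩
  rw [map_pow, hδ, h]
  simp

/-- The prime `q` ramifies: `δ² = -q`, so `(δ)` has norm `q` and is prime. An ideal of norm `q^n`
contains `q^n`, hence divides `(δ)^(2n)` and is a power of `(δ)`; its norm fixes the exponent. -/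
theorem rho_prime_pow (n : ℕ) : rho q (q ^ n) = 1 := by
  obtain ⟨δ, hδ⟩ := exists_sqrt_neg q
  have hq : q.Prime := Fact.out
  have hfin : Module.finrank ℤ (𝓞 (kField q)) = 2 := by
    rw [NumberField.RingOfIntegers.rank]
    exact QuadraticAlgebra.finrank_eq_two _ _
  have hnorm : Ideal.absNorm (Ideal.span {δ}) = q := by
    have h1 : Algebra.norm ℤ δ ^ 2 = (q : ℤ) ^ 2 := by
      rw [← map_pow, hδ, show -(q : 𝓞 (kField q)) = algebraMap ℤ _ (-(q : ℤ)) by simp,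
        Algebra.norm_algebraMap, hfin]
      ring
    rw [Ideal.absNorm_span_singleton]
    have := Int.natAbs_eq_iff_sq_eq.mpr h1
    simpa using this
  have hPprime : (Ideal.span {δ}).IsPrime :=
    Ideal.isPrime_of_irreducible_absNorm (by rw [hnorm]; exact hq)
  have hP0 : Ideal.span {δ} ≠ ⊥ := by
    intro h
    rw [h, Ideal.absNorm_bot] at hnorm
    exact hq.ne_zero hnorm.symm
  have hPmax : (Ideal.span {δ}).IsMaximal := hPprime.isMaximal hP0
  have key : ∀ I : Ideal (𝓞 (kField q)), Ideal.absNorm I = q ^ n → I = Ideal.span {δ} ^ n := by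
    intro I hI
    have hmem : ((q ^ n : ℕ) : 𝓞 (kField q)) ∈ I := hI ▸ Ideal.absNorm_mem I
    have hdvd : I ∣ Ideal.span {δ} ^ (2 * n) := by
      rw [Ideal.dvd_iff_le, Ideal.span_singleton_pow, Ideal.span_singleton_le_iff_mem, pow_mul, hδ,
        neg_pow]
      exact I.mul_mem_left _ (by exact_mod_cast hmem)
    obtain ⟨i, -, hi⟩ := (dvd_prime_pow (Ideal.prime_of_isPrime hP0 hPprime) _).mp hdvd
    have hi' : I = Ideal.span {δ} ^ i := associated_iff_eq.mp hi
    rw [hi', map_pow, hnorm] at hI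
    rw [hi', Nat.pow_right_injective hq.two_le hI]
  rw [rho, Nat.card_eq_one_iff_unique]
  refine ⟨⟨fun I J => Subtype.ext ((key I.1 I.2).trans (key J.1 J.2).symm)⟩,
    ⟨⟨Ideal.span {δ} ^ n, by rw [map_pow, hnorm]⟩⟩⟩

theorem rhoLocal_eq_one (t : ℤ) : rhoLocal q t = 1 := rho_prime_pow q _

end Ideals

/-! ### The lattice `R_q` and integration on `V_q` -/

section QuadraticSpaceIntegration

variable {q : ℕ} [Fact q.Prime]

theorem norm_le_one_iff_isIntegral {x : ℚ_[q]} : IsIntegral ℤ_[q] x ↔ ‖x‖ ≤ 1 := by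
  rw [IsIntegrallyClosed.isIntegral_iff]
  constructor
  · rintro ⟨y, rfl⟩
    exact y.2
  · intro h
    exact ⟨⟨x, h⟩, rfl⟩

theorem quadForm_eq (x : Vq q) : quadForm x = -(x.re ^ 2 + q * x.im ^ 2) := by
  rw [quadForm, QuadraticAlgebra.norm_def]
  ring

/-- As `2` is a unit in `ℤ_q`, the ring of integers is `ℤ_q[√-q]`. An integral `x` has integral
trace `2 re` and norm `re² + q im²`; the first bounds `re`, and then `q im²` integral forces `im`
integral. -/
theorem mem_Rq_iff (hq : q ≠ 2) {x : Vq q} : x ∈ Rq q ↔ ‖x.re‖ ≤ 1 ∧ ‖x.im‖ ≤ 1 := by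
  have hinj : Function.Injective (algebraMap ℚ_[q] (Vq q)) :=
    QuadraticAlgebra.algebraMap_injective
  constructor
  · intro hx
    have hx' : IsIntegral ℤ_[q] x := hx
    -- Conjugation fixes `ℤ_q`, so the conjugate is a root of the same monic polynomial.
    have hstar : IsIntegral ℤ_[q] (star x) := by
      have hC : algebraMap ℤ_[q] (Vq q) = (starRingEnd (Vq q)).comp (algebraMap ℤ_[q] (Vq q)) := by
        ext z <;>
          simp [IsScalarTower.algebraMap_apply ℤ_[q] ℚ_[q] (Vq q), starRingEnd_apply]
      obtain ⟨p, hp, hpx⟩ := hx'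
      refine ⟨p, hp, ?_⟩
      have := congrArg (starRingEnd (Vq q)) hpx
      rw [Polynomial.hom_eval₂, ← hC, map_zero] at this
      exact this
    have htr : IsIntegral ℤ_[q] (QuadraticAlgebra.trace x) := by
      rw [← isIntegral_algebraMap_iff hinj, QuadraticAlgebra.algebraMap_trace_eq_add_star]
      exact hx'.add hstar
    have hno : IsIntegral ℤ_[q] (QuadraticAlgebra.norm x) := by
      rw [← isIntegral_algebraMap_iff hinj, QuadraticAlgebra.algebraMap_norm_eq_mul_star]
      exact hx'.mul hstar
    rw [norm_le_one_iff_isIntegral] at htr hno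
    have hre : ‖x.re‖ ≤ 1 := by
      rw [QuadraticAlgebra.trace_def, zero_mul, add_zero, norm_mul, norm_two_padic hq,
        one_mul] at htr
      exact htr
    refine ⟨hre, ?_⟩
    have him : ‖(q : ℚ_[q]) * x.im ^ 2‖ ≤ 1 := by
      rw [show (q : ℚ_[q]) * x.im ^ 2 = QuadraticAlgebra.norm x - x.re ^ 2 by
        rw [QuadraticAlgebra.norm_def]; ring]
      refine (norm_sub_le_max' _ _).trans (max_le hno ?_)
      rw [norm_pow]
      exact pow_le_one₀ (norm_nonneg _) hre
    exact norm_le_one_of_prime_mul_sq him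
  · rintro ⟨h1, h2⟩
    have hω : IsIntegral ℤ_[q] (QuadraticAlgebra.omega : Vq q) := by
      refine IsIntegral.of_pow (n := 2) two_pos ?_
      have : (QuadraticAlgebra.omega : Vq q) ^ 2 = algebraMap ℤ_[q] (Vq q) (-(q : ℤ_[q])) := by
        ext <;> simp [sq]
      rw [this]
      exact isIntegral_algebraMap
    have hx : x = algebraMap ℚ_[q] (Vq q) x.re +
        algebraMap ℚ_[q] (Vq q) x.im * QuadraticAlgebra.omega := by
      ext <;> simp
    have : IsIntegral ℤ_[q] x := by
      rw [hx]
      exact (((isIntegral_algebraMap_iff hinj).mpr (norm_le_one_iff_isIntegral.mpr h1))).add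
        ((((isIntegral_algebraMap_iff hinj).mpr (norm_le_one_iff_isIntegral.mpr h2))).mul hω)
    exact this

/-- The coordinates on `V_q` with respect to the basis `1, √-q`. -/
def coordEquiv (q : ℕ) [Fact q.Prime] : ℚ_[q] × ℚ_[q] ≃ᵐ Vq q where
  toEquiv := (QuadraticAlgebra.equivProd (-(q : ℚ_[q])) 0).symm
  measurable_toFun := measurable_comap_iff.mpr measurable_id
  measurable_invFun := comap_measurable _

theorem norm_four_mul_prime (hq : q ≠ 2) : ‖(4 * q : ℚ_[q])‖ = (q : ℝ)⁻¹ := by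
  rw [show (4 : ℚ_[q]) = 2 * 2 by norm_num, norm_mul, norm_mul, norm_two_padic hq, Padic.norm_p]
  ring

theorem integral_haarV (hq : q ≠ 2) (f : Vq q → ℂ) (F G : ℚ_[q] → ℂ)
    (h : ∀ x y, f ⟨x, y⟩ = F x * G y) :
    ∫ v, f v ∂(haarV q) = ((Real.sqrt q)⁻¹ : ℝ) *
      ((∫ x, F x ∂(haarQ q)) * ∫ y, G y ∂(haarQ q)) := by
  have h1 : haarV q = ENNReal.ofReal (Real.sqrt ‖(4 * q : ℚ_[q])‖) •
      Measure.map (coordEquiv q) ((haarQ q).prod (haarQ q)) := rfl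
  rw [h1, integral_smul_measure, integral_map_equiv, norm_four_mul_prime hq, Real.sqrt_inv,
    ENNReal.toReal_ofReal (by positivity), ← integral_prod_mul, Complex.real_smul]
  congr 2
  ext p
  exact h p.1 p.2

theorem psi_mul_quadForm (b x y : ℚ_[q]) :
    psi (b * quadForm (⟨x, y⟩ : Vq q)) = psi (-b * x ^ 2) * psi (-b * (q : ℚ_[q]) * y ^ 2) := by
  rw [← psi_add, quadForm_eq]
  congr 1
  ring

theorem integral_psi_quadForm_mul_phi (hq : q ≠ 2) (b : ℚ_[q]) :
    ∫ v, psi (b * quadForm v) * phi q v ∂(haarV q) =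
      ((Real.sqrt q)⁻¹ : ℝ) * normIntegral b := by
  have hm : MeasurableSet (Metric.closedBall (0 : ℚ_[q]) 1) :=
    Metric.isClosed_closedBall.measurableSet
  rw [normIntegral, gaussIntegral, gaussIntegral, ← integral_indicator hm, ← integral_indicator hm]
  refine integral_haarV hq _ _ _ fun x y => ?_
  rw [psi_mul_quadForm, phi]
  by_cases hx : ‖x‖ ≤ 1 <;> by_cases hy : ‖y‖ ≤ 1 <;>
    simp [Set.indicator, mem_Rq_iff hq, hx, hy]

theorem integral_indicator_pow_mul_psi (n : ℕ) (c : ℚ_[q]) :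
    ∫ x, {x : ℚ_[q] | ‖(q : ℚ_[q]) ^ n * x‖ ≤ 1}.indicator (fun x => psi (c * x ^ 2)) x ∂(haarQ q) =
      (q : ℂ) ^ n * gaussIntegral (c / (q : ℚ_[q]) ^ (2 * n)) := by
  have hm : MeasurableSet (Metric.closedBall (0 : ℚ_[q]) 1) :=
    Metric.isClosed_closedBall.measurableSet
  have hq0 := natCast_prime_ne_zero (q := q)
  rw [gaussIntegral, ← integral_indicator hm, ← integral_comp_prime_pow_mul]
  congr 1
  ext x
  by_cases h : ‖(q : ℚ_[q]) ^ n * x‖ ≤ 1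
  · rw [Set.indicator_of_mem (by exact h), Set.indicator_of_mem (by simpa using h)]
    congr 1
    field_simp
    ring
  · rw [Set.indicator_of_notMem (by exact h), Set.indicator_of_notMem (by simpa using h)]

/-- Scaling `q^{-n} R_q` to `R_q` gives `q^{-1/2} · q^{2n} · normIntegral(q^{-2n})`, which is
`q^{-1/2} · i√q = i` for every `n ≥ 1`. For `n = 0` the integral is only the volume `q^{-1/2}`. -/
theorem weilIndex_eq (hq : q % 4 = 3) : weilIndex q = Complex.I := by
  have hq2 : q ≠ 2 := by omega
  have hq0 : (q : ℂ) ≠ 0 := by exact_mod_cast (Fact.out : q.Prime).ne_zero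
  have hs0 : ((Real.sqrt q : ℝ) : ℂ) ≠ 0 := by
    have : 0 < Real.sqrt q := Real.sqrt_pos.mpr (by exact_mod_cast (Fact.out : q.Prime).pos)
    exact_mod_cast this.ne'
  refine Tendsto.limUnder_eq (tendsto_const_nhds.congr' ?_)
  filter_upwards [eventually_ge_atTop 1] with n hn
  have hset : {x : Vq q | (q : ℚ_[q]) ^ n • x ∈ Rq q} = (coordEquiv q).symm ⁻¹'
      ({x : ℚ_[q] | ‖(q : ℚ_[q]) ^ n * x‖ ≤ 1} ×ˢ {x : ℚ_[q] | ‖(q : ℚ_[q]) ^ n * x‖ ≤ 1}) := by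
    ext x
    simp only [Set.mem_ofPred_eq, mem_Rq_iff hq2]
    rfl
  have hS : MeasurableSet {x : ℚ_[q] | ‖(q : ℚ_[q]) ^ n * x‖ ≤ 1} :=
    (isClosed_le (by fun_prop) continuous_const).measurableSet
  have hm : MeasurableSet {x : Vq q | (q : ℚ_[q]) ^ n • x ∈ Rq q} := by
    rw [hset]
    exact (coordEquiv q).symm.measurable (hS.prod hS)
  rw [← integral_indicator hm, integral_haarV hq2 _
    ({x : ℚ_[q] | ‖(q : ℚ_[q]) ^ n * x‖ ≤ 1}.indicator fun x => psi (-1 * x ^ 2))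
    ({x : ℚ_[q] | ‖(q : ℚ_[q]) ^ n * x‖ ≤ 1}.indicator fun x => psi (-1 * (q : ℚ_[q]) * x ^ 2)),
    integral_indicator_pow_mul_psi, integral_indicator_pow_mul_psi]
  · have h1 := normIntegral_div_prime_pow hq (z := 1) (by simp) (2 * n - 1)
    rw [show 2 * n - 1 + 1 = 2 * n by omega, normIntegral] at h1
    have e1 : -(((1 : ℤ_[q]) : ℚ_[q]) / (q : ℚ_[q]) ^ (2 * n)) = -1 / (q : ℚ_[q]) ^ (2 * n) := by
      push_cast
      ring
    have e2 : -1 / (q : ℚ_[q]) ^ (2 * n) * (q : ℚ_[q]) =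
        -1 * (q : ℚ_[q]) / (q : ℚ_[q]) ^ (2 * n) := by ring
    rw [e1, e2] at h1
    rw [mul_mul_mul_comm, h1]
    simp only [map_one, Int.cast_one, mul_one]
    push_cast
    field_simp
    ring
  · intro x y
    have h2 := psi_mul_quadForm 1 x y
    rw [one_mul] at h2
    have hmem : (⟨x, y⟩ : Vq q) ∈ {x : Vq q | (q : ℚ_[q]) ^ n • x ∈ Rq q} ↔
        ‖(q : ℚ_[q]) ^ n * x‖ ≤ 1 ∧ ‖(q : ℚ_[q]) ^ n * y‖ ≤ 1 := mem_Rq_iff hq2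
    by_cases hx : ‖(q : ℚ_[q]) ^ n * x‖ ≤ 1
    · by_cases hy : ‖(q : ℚ_[q]) ^ n * y‖ ≤ 1
      · rw [Set.indicator_of_mem (hmem.mpr ⟨hx, hy⟩), Set.indicator_of_mem (by exact hx),
          Set.indicator_of_mem (by exact hy), h2]
      · rw [Set.indicator_of_notMem (fun h => hy (hmem.mp h).2),
          Set.indicator_of_notMem (a := y) (by exact hy), mul_zero]
    · rw [Set.indicator_of_notMem (fun h => hx (hmem.mp h).1),
        Set.indicator_of_notMem (a := x) (by exact hx), zero_mul]

theorem wMat_mul_nMat (b : ℚ_[q]) : (wMat q * nMat b).1 = !![0, 1; -1, -b] := by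
  change !![0, 1; -1, 0] * !![1, b; 0, 1] = _
  simp

theorem weilRep_wMat_mul_nMat (hq : q % 4 = 3) (b : ℚ_[q]) :
    weilRep (wMat q * nMat b) (phi q) 0 = cq q * normIntegral b := by
  have h00 : (wMat q * nMat b).1 0 0 = 0 := by rw [wMat_mul_nMat]; simp
  have h10 : (wMat q * nMat b).1 1 0 = -1 := by rw [wMat_mul_nMat]; simp
  have h11 : (wMat q * nMat b).1 1 1 = -b := by rw [wMat_mul_nMat]; simp
  have hint := integral_psi_quadForm_mul_phi (q := q) (by omega) b
  have hpol : ∀ y : Vq q, QuadraticMap.polar quadForm 0 y = 0 := fun y => by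
    simp [QuadraticMap.polar, quadForm]
  rw [weilRep, h10, if_neg (by simp), h00, h11, weilIndex_eq hq, chi_neg_one hq]
  simp only [hpol, zero_mul, sub_zero, zero_add, div_neg, neg_mul, neg_neg, div_one]
  rw [hint, cq]
  simp [mul_assoc]

theorem iwasawaHeight_wMat_mul_nMat (b : ℚ_[q]) :
    iwasawaHeight (wMat q * nMat b) = (max 1 ‖b‖)⁻¹ := by
  have h10 : (wMat q * nMat b).1 1 0 = -1 := by rw [wMat_mul_nMat]; simp
  have h11 : (wMat q * nMat b).1 1 1 = -b := by rw [wMat_mul_nMat]; simp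
  rw [iwasawaHeight, h10, h11, norm_neg, norm_neg, norm_one]

theorem whittakerIntegrand_one (hq : q % 4 = 3) (t : ℚ_[q]) (s : ℂ) (b : ℚ_[q]) :
    whittakerIntegrand t 1 s b =
      cq q * normIntegral b * (((max 1 ‖b‖)⁻¹ : ℝ) : ℂ) ^ s * psi (-(t * b)) := by
  rw [whittakerIntegrand, sectionPhi, mul_one, weilRep_wMat_mul_nMat hq,
    iwasawaHeight_wMat_mul_nMat]

end QuadraticSpaceIntegration

/-! ### The Whittaker integral -/

section Whittaker

variable {q : ℕ} [Fact q.Prime]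

/-- The quadratic character modulo `q` on `ℤ_q`, extended by zero to `ℚ_q`. -/
def residueChar (x : ℚ_[q]) : ℂ :=
  if h : ‖x‖ ≤ 1 then ((quadraticChar (ZMod q) (PadicInt.toZMod ⟨x, h⟩) : ℤ) : ℂ) else 0

theorem residueChar_coe (z : ℤ_[q]) :
    residueChar (z : ℚ_[q]) = ((quadraticChar (ZMod q) (PadicInt.toZMod z) : ℤ) : ℂ) :=
  dif_pos z.2

theorem residueChar_eq_of_norm_sub_lt_one {x y : ℚ_[q]} (h : ‖x - y‖ < 1) :
    residueChar x = residueChar y := by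
  have key : ∀ x y : ℚ_[q], ‖x - y‖ < 1 → ‖x‖ ≤ 1 → ‖y‖ ≤ 1 := fun x y h hx => by
    rw [← sub_sub_cancel x y]
    exact (norm_sub_le_max' _ _).trans (max_le hx h.le)
  by_cases hx : ‖x‖ ≤ 1
  · obtain ⟨w, rfl⟩ := exists_padicInt_coe_eq (key x y h hx)
    obtain ⟨z, rfl⟩ := exists_padicInt_coe_eq hx
    rw [residueChar_coe, residueChar_coe, toZMod_eq_toZMod_iff.mpr]
    exact_mod_cast h
  · have hy : ¬ ‖y‖ ≤ 1 := fun hy => hx (key y x (by rwa [norm_sub_rev]) hy)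
    rw [residueChar, residueChar, dif_neg hx, dif_neg hy]

theorem continuous_residueChar : Continuous (residueChar : ℚ_[q] → ℂ) := by
  rw [continuous_iff_continuousAt]
  intro x
  refine continuousAt_const.congr (f := fun _ => residueChar x) ?_
  filter_upwards [Metric.ball_mem_nhds x one_pos] with y hy
  rw [Metric.mem_ball, dist_eq_norm] at hy
  exact (residueChar_eq_of_norm_sub_lt_one hy).symm

/-- The integral of `χ(x) ψ(c x)` over `ℤ_q`. -/
def charIntegral (c : ℚ_[q]) : ℂ :=
  ∫ x in Metric.closedBall 0 1, residueChar x * psi (c * x) ∂(haarQ q)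

/-- Here `ψ(cx) = 1` on `ℤ_q`, and a nontrivial character sums to zero. -/
theorem charIntegral_of_norm_le_one (hq : q ≠ 2) {c : ℚ_[q]} (hc : ‖c‖ ≤ 1) :
    charIntegral c = 0 := by
  rw [charIntegral, setIntegral_closedBall_eq_sum _
    (fun a => ((quadraticChar (ZMod q) a : ℤ) : ℂ))]
  · have := quadraticChar_sum_zero (F := ZMod q) (by rwa [ZMod.ringChar_zmod_n])
    rw [← Int.cast_sum, this]
    simp
  · intro z
    rw [residueChar_coe, psi_eq_one_iff.mpr, mul_one]
    rw [norm_mul]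
    exact mul_le_one₀ hc (norm_nonneg _) z.2

theorem charIntegral_div_prime (hq : q % 4 = 3) {w : ℤ_[q]} (hw : ‖w‖ = 1) :
    charIntegral ((w : ℚ_[q]) / (q : ℚ_[q])) = (q : ℂ)⁻¹ *
      ((quadraticChar (ZMod q) (-PadicInt.toZMod w) : ℤ) : ℂ) *
        (Complex.I * (Real.sqrt q : ℝ)) := by
  rw [norm_eq_one_iff_toZMod_ne_zero] at hw
  rw [mul_assoc, ← sum_quadraticChar_mul_stdAddChar q hq (neg_ne_zero.mpr hw), charIntegral]
  refine setIntegral_closedBall_eq_sum _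
    (fun a => ((quadraticChar (ZMod q) a : ℤ) : ℂ) * ZMod.stdAddChar (-PadicInt.toZMod w * a)) ?_
  intro x
  rw [residueChar_coe, show (w : ℚ_[q]) / q * (x : ℚ_[q]) = ((w * x : ℤ_[q]) : ℚ_[q]) / q by
    push_cast; ring, psi_div_prime]
  simp

/-- Translation by `q` preserves the residue character but multiplies `ψ(cx)` by `ψ(cq) ≠ 1`.
Together with the vanishing for `|c| ≤ 1`, only `|c| = q` remains. -/
theorem charIntegral_of_lt_norm {c : ℚ_[q]} (hc : q < ‖c‖) : charIntegral c = 0 := by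
  have hqr : (0 : ℝ) < q := by exact_mod_cast (Fact.out : q.Prime).pos
  have h1 : psi (c * (q : ℚ_[q])) ≠ 1 := by
    rw [Ne, psi_eq_one_iff, norm_mul, Padic.norm_p, not_le, ← div_eq_mul_inv, one_lt_div hqr]
    exact hc
  have h2 : charIntegral c = psi (c * (q : ℚ_[q])) * charIntegral c := by
    conv_lhs => rw [charIntegral, ← setIntegral_closedBall_add_right _
      (y := (q : ℚ_[q])) Padic.norm_p_lt_one.le]
    rw [charIntegral, ← integral_const_mul]
    congr 1
    ext x
    rw [mul_add, psi_add, residueChar_eq_of_norm_sub_lt_one (x := x + (q : ℚ_[q])) (y := x)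
      (by rw [add_sub_cancel_left]; exact Padic.norm_p_lt_one)]
    ring
  have h3 : (1 - psi (c * (q : ℚ_[q]))) * charIntegral c = 0 := by linear_combination h2
  exact (mul_eq_zero.mp h3).resolve_left (sub_ne_zero.mpr h1.symm)

variable (q) in
/-- The decomposition of `ℚ_q` into `ℤ_q` and the spheres of radius `q ^ k`, `k ≥ 1`. -/
def shell : ℕ → Set ℚ_[q]
  | 0 => Metric.closedBall 0 1
  | k + 1 => Metric.sphere 0 ((q : ℝ) ^ (k + 1))

theorem isCompact_shell (k : ℕ) : IsCompact (shell q k) := by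
  cases k with
  | zero => exact isCompact_closedBall _ _
  | succ k => exact isCompact_sphere _ _

theorem norm_eq_pow_of_mem_shell {k : ℕ} {x : ℚ_[q]} (hx : x ∈ shell q (k + 1)) :
    ‖x‖ = (q : ℝ) ^ (k + 1) := by
  simpa [shell] using hx

theorem max_one_norm_of_mem_shell {k : ℕ} {x : ℚ_[q]} (hx : x ∈ shell q k) :
    max 1 ‖x‖ = (q : ℝ) ^ k := by
  have hq1 : (1 : ℝ) ≤ q := by exact_mod_cast (Fact.out : q.Prime).one_le
  cases k with
  | zero => simpa [shell] using hx
  | succ k => rw [norm_eq_pow_of_mem_shell hx, max_eq_right (one_le_pow₀ hq1)]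

theorem pairwise_disjoint_shell : Pairwise (Function.onFun Disjoint (shell q)) := by
  have hq1 : 1 < q := (Fact.out : q.Prime).one_lt
  intro i j hij
  rw [Function.onFun, Set.disjoint_left]
  intro x hi hj
  have h := (max_one_norm_of_mem_shell hi).symm.trans (max_one_norm_of_mem_shell hj)
  exact hij (Nat.pow_right_injective hq1 (by exact_mod_cast h))

theorem iUnion_shell : ⋃ k, shell q k = Set.univ := by
  rw [Set.eq_univ_iff_forall]
  intro x
  rw [Set.mem_iUnion]
  by_cases hx : ‖x‖ ≤ 1
  · exact ⟨0, by simpa [shell] using hx⟩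
  · have hx0 : x ≠ 0 := by
      rintro rfl
      simp at hx
    have h1 := Padic.norm_eq_zpow_neg_valuation hx0
    have hpos : 0 < -x.valuation := by
      by_contra hle
      apply hx
      rw [h1]
      exact zpow_le_one_of_nonpos₀ (by exact_mod_cast (Fact.out : q.Prime).one_le) (not_lt.mp hle)
    obtain ⟨k, hk⟩ := Int.eq_ofNat_of_zero_le hpos.le
    obtain ⟨m, rfl⟩ : ∃ m, k = m + 1 := ⟨k - 1, by omega⟩
    refine ⟨m + 1, ?_⟩
    rw [shell, mem_sphere_zero_iff_norm, h1, hk, zpow_natCast]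

theorem haarQ_real_shell_le (k : ℕ) : (haarQ q).real (shell q k) ≤ (q : ℝ) ^ k := by
  have hqr : (0 : ℝ) < q := by exact_mod_cast (Fact.out : q.Prime).pos
  have h1 : (haarQ q).real (Metric.closedBall 0 ((q : ℝ) ^ k)) = (q : ℝ) ^ k := by
    have h := integral_comp_prime_pow_mul (q := q) k ((Metric.closedBall 0 1).indicator 1)
    have h2 : (fun x : ℚ_[q] => (Metric.closedBall 0 1).indicator (1 : ℚ_[q] → ℂ)
        ((q : ℚ_[q]) ^ k * x)) = (Metric.closedBall 0 ((q : ℝ) ^ k)).indicator fun _ => 1 := by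
      ext x
      have : (q : ℚ_[q]) ^ k * x ∈ Metric.closedBall (0 : ℚ_[q]) 1 ↔
          x ∈ Metric.closedBall (0 : ℚ_[q]) ((q : ℝ) ^ k) := by
        rw [mem_closedBall_zero_iff, mem_closedBall_zero_iff, norm_mul, norm_pow, Padic.norm_p,
          inv_pow, inv_mul_le_one₀ (by positivity)]
      by_cases hx : x ∈ Metric.closedBall (0 : ℚ_[q]) ((q : ℝ) ^ k)
      · rw [Set.indicator_of_mem hx, Set.indicator_of_mem (this.mpr hx)]
        rfl
      · rw [Set.indicator_of_notMem hx, Set.indicator_of_notMem (mt this.mp hx)]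
    rw [h2, integral_indicator Metric.isClosed_closedBall.measurableSet,
      integral_indicator Metric.isClosed_closedBall.measurableSet, setIntegral_const] at h
    simp only [Pi.one_apply, setIntegral_const, Complex.real_smul, mul_one, Measure.real,
      haarQ_closedBall_one] at h
    simp only [ENNReal.toReal_one, Complex.ofReal_one, mul_one] at h
    exact_mod_cast h
  rw [← h1]
  refine measureReal_mono ?_ (measure_closedBall_lt_top).ne
  intro x hx
  rw [mem_closedBall_zero_iff, ← max_one_norm_of_mem_shell hx]
  exact le_max_right _ _

theorem normIntegral_of_mem_shell (hq : q % 4 = 3) {k : ℕ} {b : ℚ_[q]}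
    (hb : b ∈ shell q (k + 1)) :
    normIntegral b = ((q : ℂ) ^ (k + 1))⁻¹ * residueChar ((q : ℚ_[q]) ^ (k + 1) * b) *
      (Complex.I * (Real.sqrt q : ℝ)) := by
  have hqr : (q : ℝ) ≠ 0 := by exact_mod_cast (Fact.out : q.Prime).ne_zero
  have h1 : ‖(q : ℚ_[q]) ^ (k + 1) * b‖ = 1 := by
    rw [norm_mul, norm_pow, Padic.norm_p, norm_eq_pow_of_mem_shell hb, inv_pow, inv_mul_cancel₀]
    exact pow_ne_zero _ hqr
  obtain ⟨z, hz⟩ := exists_padicInt_coe_eq h1.le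
  have hz1 : ‖z‖ = 1 := by rw [← h1, ← hz]; rfl
  have hb' : b = (z : ℚ_[q]) / (q : ℚ_[q]) ^ (k + 1) := by
    rw [hz, mul_div_cancel_left₀ _ (pow_ne_zero _ natCast_prime_ne_zero)]
  rw [← hz, residueChar_coe, ← normIntegral_div_prime_pow hq hz1, hb']

theorem whittakerIntegrand_eqOn_shell (hq : q % 4 = 3) (t : ℚ_[q]) (s : ℂ) (k : ℕ) :
    Set.EqOn (whittakerIntegrand t 1 s)
      (fun b => cq q * (Complex.I * (Real.sqrt q : ℝ)) * ((q : ℂ) ^ (k + 1))⁻¹ *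
        ((((q : ℝ) ^ (k + 1))⁻¹ : ℝ) : ℂ) ^ s *
          (residueChar ((q : ℚ_[q]) ^ (k + 1) * b) * psi (-(t * b)))) (shell q (k + 1)) := by
  intro b hb
  rw [whittakerIntegrand_one hq, normIntegral_of_mem_shell hq hb, max_one_norm_of_mem_shell hb]
  ring

theorem whittakerIntegrand_eqOn_closedBall (hq : q % 4 = 3) {t : ℚ_[q]} (ht : ‖t‖ ≤ 1) (s : ℂ) :
    Set.EqOn (whittakerIntegrand t 1 s) (fun _ => cq q) (shell q 0) := by
  intro b hb
  have hb1 : ‖b‖ ≤ 1 := by simpa [shell] using hb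
  have h1 : psi (-(t * b)) = 1 := by
    rw [psi_eq_one_iff, norm_neg, norm_mul]
    exact mul_le_one₀ ht (norm_nonneg _) hb1
  rw [whittakerIntegrand_one hq, normIntegral_of_norm_le_one hb1, max_one_norm_of_mem_shell hb, h1]
  simp

theorem integrableOn_whittakerIntegrand_shell (hq : q % 4 = 3) {t : ℚ_[q]} (ht : ‖t‖ ≤ 1) (s : ℂ)
    (k : ℕ) : IntegrableOn (whittakerIntegrand t 1 s) (shell q k) (haarQ q) := by
  have hm := (isCompact_shell (q := q) k).isClosed.measurableSet
  cases k with
  | zero =>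
    refine IntegrableOn.congr_fun ?_ (whittakerIntegrand_eqOn_closedBall hq ht s).symm hm
    exact continuousOn_const.integrableOn_compact (isCompact_shell 0)
  | succ k =>
    refine IntegrableOn.congr_fun ?_ (whittakerIntegrand_eqOn_shell hq t s k).symm hm
    refine ContinuousOn.integrableOn_compact (isCompact_shell _) (Continuous.continuousOn ?_)
    have h1 : Continuous fun b : ℚ_[q] => residueChar ((q : ℚ_[q]) ^ (k + 1) * b) :=
      continuous_residueChar.comp (by fun_prop)
    have h2 : Continuous fun b : ℚ_[q] => psi (-(t * b)) := continuous_psi.comp (by fun_prop)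
    exact continuous_const.mul (h1.mul h2)

theorem norm_residueChar_le_one (x : ℚ_[q]) : ‖residueChar x‖ ≤ 1 := by
  rw [residueChar]
  split_ifs with h
  · rcases quadraticChar_isQuadratic (ZMod q) (PadicInt.toZMod ⟨x, h⟩) with h | h | h <;> simp [h]
  · simp

/-- On the sphere of radius `q^k` the integrand is at most `C q^{-k} q^{-k Re s}` and the volume at
most `q^k`, so a geometric series of ratio `q^{-Re s}` dominates; `Re s > 0` already suffices. -/
theorem integrable_whittakerIntegrand (hq : q % 4 = 3) {t : ℚ_[q]} (ht : ‖t‖ ≤ 1) {s : ℂ}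
    (hs : 0 < s.re) : Integrable (whittakerIntegrand t 1 s) (haarQ q) := by
  have hq1 : (1 : ℝ) < q := by exact_mod_cast (Fact.out : q.Prime).one_lt
  have hq0 : (0 : ℝ) < q := by linarith
  rw [← integrableOn_univ, ← iUnion_shell]
  refine integrableOn_iUnion_of_summable_integral_norm
    (integrableOn_whittakerIntegrand_shell hq ht s) ?_
  rw [← summable_nat_add_iff 1]
  set C : ℝ := ‖cq q * (Complex.I * (Real.sqrt q : ℝ))‖ with hC
  have hr : (q : ℝ)⁻¹ ^ s.re < 1 :=
    Real.rpow_lt_one (by positivity) (inv_lt_one_of_one_lt₀ hq1) hs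
  have hgeo : Summable fun k : ℕ => C * (((q : ℝ)⁻¹ ^ s.re) ^ (k + 1)) :=
    ((summable_nat_add_iff 1).mpr
      (summable_geometric_of_lt_one (by positivity) hr)).mul_left C
  refine Summable.of_nonneg_of_le (fun k => integral_nonneg fun _ => norm_nonneg _) (fun k => ?_)
    hgeo
  have hbound : ∀ b ∈ shell q (k + 1), ‖‖whittakerIntegrand t 1 s b‖‖ ≤
      C * ((q : ℝ) ^ (k + 1))⁻¹ * (((q : ℝ)⁻¹ ^ s.re) ^ (k + 1)) := by
    intro b hb
    rw [norm_norm, whittakerIntegrand_eqOn_shell hq t s k hb]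
    simp only
    rw [norm_mul, norm_mul, norm_mul, norm_mul (residueChar _), norm_psi, mul_one, ← hC,
      Complex.norm_cpow_eq_rpow_re_of_pos (by positivity), norm_inv, norm_pow, Complex.norm_natCast,
      ← inv_pow, ← Real.rpow_natCast_mul (by positivity), mul_comm ((k + 1 : ℕ) : ℝ),
      Real.rpow_mul_natCast (by positivity)]
    exact mul_le_of_le_one_right (by positivity) (norm_residueChar_le_one _)
  have h2 := norm_setIntegral_le_of_norm_le_const
    ((isCompact_shell (q := q) (k + 1)).measure_lt_top (μ := haarQ q)) hbound
  refine (Real.le_norm_self _).trans (h2.trans ?_)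
  refine (mul_le_mul_of_nonneg_left (haarQ_real_shell_le (k + 1)) (by positivity)).trans ?_
  apply le_of_eq
  field_simp

/-- The substitution `b ↦ q^(k+1) b` contributes `q^(k+1)`, cancelling the decay of `normIntegral`.
-/
theorem setIntegral_whittakerIntegrand_shell (hq : q % 4 = 3) (t : ℚ_[q]) (s : ℂ) (k : ℕ) :
    ∫ b in shell q (k + 1), whittakerIntegrand t 1 s b ∂(haarQ q) =
      cq q * (Complex.I * (Real.sqrt q : ℝ)) * ((((q : ℝ) ^ (k + 1))⁻¹ : ℝ) : ℂ) ^ s *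
        charIntegral (-(t / (q : ℚ_[q]) ^ (k + 1))) := by
  have hqC : (q : ℂ) ≠ 0 := by exact_mod_cast (Fact.out : q.Prime).ne_zero
  have hq0 := natCast_prime_ne_zero (q := q)
  have hqr : (0 : ℝ) < q := by exact_mod_cast (Fact.out : q.Prime).pos
  have hm := (isCompact_shell (q := q) (k + 1)).isClosed.measurableSet
  have h1 : ∫ b in shell q (k + 1),
      residueChar ((q : ℚ_[q]) ^ (k + 1) * b) * psi (-(t * b)) ∂(haarQ q) =
      (q : ℂ) ^ (k + 1) * charIntegral (-(t / (q : ℚ_[q]) ^ (k + 1))) := by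
    rw [charIntegral, ← integral_indicator hm,
      ← integral_indicator Metric.isClosed_closedBall.measurableSet, ← integral_comp_prime_pow_mul]
    congr 1
    ext b
    have hn : ‖(q : ℚ_[q]) ^ (k + 1) * b‖ = ((q : ℝ) ^ (k + 1))⁻¹ * ‖b‖ := by
      rw [norm_mul, norm_pow, Padic.norm_p, inv_pow]
    have hsph : b ∈ shell q (k + 1) ↔ ‖(q : ℚ_[q]) ^ (k + 1) * b‖ = 1 := by
      rw [shell, mem_sphere_zero_iff_norm, hn, inv_mul_eq_one₀ (by positivity), eq_comm]
    by_cases hb : b ∈ shell q (k + 1)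
    · rw [Set.indicator_of_mem hb, Set.indicator_of_mem
        (mem_closedBall_zero_iff.mpr (hsph.mp hb).le)]
      congr 2
      field_simp
    · rw [Set.indicator_of_notMem hb]
      by_cases hb1 : (q : ℚ_[q]) ^ (k + 1) * b ∈ Metric.closedBall (0 : ℚ_[q]) 1
      · rw [Set.indicator_of_mem hb1]
        obtain ⟨z, hz⟩ := exists_padicInt_coe_eq (mem_closedBall_zero_iff.mp hb1)
        -- The sphere may be replaced by the whole ball after rescaling, because the residue
        -- character vanishes on `qℤ_q`.
        have hz0 : PadicInt.toZMod z = 0 := by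
          by_contra hne
          rw [← Ne, ← norm_eq_one_iff_toZMod_ne_zero] at hne
          exact hb (hsph.mpr (by rw [← hz]; exact hne))
        rw [← hz, residueChar_coe, hz0]
        simp
      · rw [Set.indicator_of_notMem hb1]
  rw [setIntegral_congr_fun hm (whittakerIntegrand_eqOn_shell hq t s k), integral_const_mul, h1]
  field_simp

theorem inv_pow_cpow (m : ℕ) (s : ℂ) :
    ((((q : ℝ) ^ m)⁻¹ : ℝ) : ℂ) ^ s = (q : ℂ) ^ (-s * m) := by
  have hqr : (0 : ℝ) < q := by exact_mod_cast (Fact.out : q.Prime).pos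
  have hqC : (q : ℂ) ≠ 0 := by exact_mod_cast hqr.ne'
  rw [Complex.cpow_def_of_ne_zero
    (Complex.ofReal_ne_zero.mpr (inv_ne_zero (pow_ne_zero _ hqr.ne'))),
    Complex.cpow_def_of_ne_zero hqC, ← Complex.ofReal_log (by positivity), Real.log_inv,
    Real.log_pow, ← Complex.natCast_log]
  push_cast
  congr 1
  ring

theorem whittaker_one (hq : q % 4 = 3) {t : ℤ} (ht : t ≠ 0) {s : ℂ} (hs : 0 < s.re) :
    whittaker (t : ℚ_[q]) 1 s =
      (1 - (chi (t : ℚ_[q]) : ℂ) * (q : ℂ) ^ (-s * ((padicValInt q t : ℂ) + 1))) * cq q := by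
  have hq2 : q ≠ 2 := by omega
  have hqr : (0 : ℝ) < q := by exact_mod_cast (Fact.out : q.Prime).pos
  have hq1 : (1 : ℝ) < q := by exact_mod_cast (Fact.out : q.Prime).one_lt
  have hqC : (q : ℂ) ≠ 0 := by exact_mod_cast hqr.ne'
  have hq0 := natCast_prime_ne_zero (q := q)
  have ht1 : ‖(t : ℚ_[q])‖ ≤ 1 := Padic.norm_int_le_one t
  obtain ⟨u, hu, htu⟩ := exists_eq_prime_pow_mul (q := q) t ht
  set n := padicValInt q t
  have hu' : ‖(u : ℚ_[q])‖ = 1 := hu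
  have hchi : chi (t : ℚ_[q]) = quadraticChar (ZMod q) (PadicInt.toZMod u) := by
    rw [htu, chi_prime_pow_mul hq2 n hu]
  have hnorm : ∀ k : ℕ, ‖-((t : ℚ_[q]) / (q : ℚ_[q]) ^ (k + 1))‖ =
      (q : ℝ) ^ ((k + 1 : ℤ) - n) := fun k => by
    rw [htu, norm_neg, norm_div, norm_mul, norm_pow, norm_pow, hu', Padic.norm_p, mul_one,
      zpow_sub₀ hqr.ne', zpow_natCast, ← Nat.cast_succ, zpow_natCast]
    simp only [inv_pow, div_inv_eq_mul]
    rw [mul_comm, div_eq_mul_inv]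
  -- The shell of index `k + 1` leads to `charIntegral` at an argument of norm `q^(k+1-n)`, which
  -- equals `q` only for `k = n`.
  have hterm : ∀ k, ∫ b in shell q k, whittakerIntegrand (t : ℚ_[q]) 1 s b ∂(haarQ q) =
      (if k = 0 then cq q else 0) + if k = n + 1 then
        -((chi (t : ℚ_[q]) : ℂ) * (q : ℂ) ^ (-s * ((n : ℂ) + 1)) * cq q) else 0 := by
    intro k
    cases k with
    | zero =>
      rw [setIntegral_congr_fun (isCompact_shell 0).isClosed.measurableSet
        (whittakerIntegrand_eqOn_closedBall hq ht1 s), setIntegral_const]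
      simp [shell, Measure.real, haarQ_closedBall_one]
    | succ k =>
      rw [setIntegral_whittakerIntegrand_shell hq, if_neg k.succ_ne_zero, zero_add]
      rcases lt_trichotomy k n with hk | hk | hk
      · rw [charIntegral_of_norm_le_one hq2, mul_zero, if_neg (by omega)]
        rw [hnorm]
        exact zpow_le_one_of_nonpos₀ hq1.le (by omega)
      -- The Gauss factor of `normIntegral` and that of `charIntegral` combine to `(i√q)² q⁻¹ = -1`.
      · have hc : -((t : ℚ_[q]) / (q : ℚ_[q]) ^ (k + 1)) =
            (((-u : ℤ_[q])) : ℚ_[q]) / (q : ℚ_[q]) := by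
          rw [htu, hk]
          push_cast
          field_simp
          ring
        have hsq : ((Real.sqrt q : ℝ) : ℂ) ^ 2 = q := by
          rw [← Complex.ofReal_pow, Real.sq_sqrt hqr.le]
          simp
        rw [if_pos (by rw [hk]), hc, charIntegral_div_prime hq (by rwa [norm_neg]), inv_pow_cpow, hchi, hk,
          map_neg PadicInt.toZMod, neg_neg]
        push_cast
        field_simp
        rw [hsq]
        linear_combination (cq q * (quadraticChar (ZMod q) (PadicInt.toZMod u) : ℂ) *
          (q : ℂ) ^ (-(s * ((n : ℂ) + 1))) * q) * Complex.I_sq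
      · rw [charIntegral_of_lt_norm, mul_zero, if_neg (by omega)]
        rw [hnorm]
        conv_lhs => rw [← zpow_one (q : ℝ)]
        exact zpow_lt_zpow_right₀ hq1 (by omega)
  have hint := integrable_whittakerIntegrand hq ht1 hs
  have hsum1 := hasSum_integral_iUnion (μ := haarQ q) (f := whittakerIntegrand (t : ℚ_[q]) 1 s)
    (fun k => (isCompact_shell (q := q) k).isClosed.measurableSet) pairwise_disjoint_shell
    hint.integrableOn
  rw [iUnion_shell, setIntegral_univ] at hsum1
  simp_rw [hterm] at hsum1
  have hsum2 := (hasSum_ite_eq 0 (cq q)).add (hasSum_ite_eq (n + 1)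
    (-((chi (t : ℚ_[q]) : ℂ) * (q : ℂ) ^ (-s * ((n : ℂ) + 1)) * cq q)))
  rw [whittaker, hsum1.unique hsum2]
  ring

end Whittaker

/-! ### The analytic continuation -/

section Continuation

variable {q : ℕ} [Fact q.Prime]

theorem hasDerivAt_one_sub_mul_cpow (a c n : ℂ) (s : ℂ) :
    HasDerivAt (fun s : ℂ => (1 - a * (q : ℂ) ^ (-s * n)) * c)
      (a * (q : ℂ) ^ (-s * n) * (Real.log q : ℂ) * n * c) s := by
  have hq0 : (q : ℂ) ≠ 0 := by exact_mod_cast (Fact.out : q.Prime).ne_zero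
  have h1 : HasDerivAt (fun s : ℂ => -s * n) (-1 * n) s := (hasDerivAt_id s).neg.mul_const n
  have h2 := ((((h1.const_cpow (c := (q : ℂ)) (Or.inl hq0)).const_mul a).const_sub 1).mul_const c)
  refine h2.congr_deriv ?_
  rw [← Complex.natCast_log]
  ring

/-- The closed form is entire and equals the integral for `Re s > 1`. Any other normalized function
agrees with it near `s = 2`, hence everywhere by the identity theorem. -/
theorem isNormalizedWhittaker_iff (hq : q % 4 = 3) {t : ℤ} (ht : t ≠ 0) (W : ℂ → ℂ) :
    IsNormalizedWhittaker (t : ℚ_[q]) W ↔ ∀ s, W s =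
      (1 - (chi (t : ℚ_[q]) : ℂ) * (q : ℂ) ^ (-s * ((padicValInt q t : ℂ) + 1))) * cq q := by
  set V : ℂ → ℂ := fun s =>
    (1 - (chi (t : ℚ_[q]) : ℂ) * (q : ℂ) ^ (-s * ((padicValInt q t : ℂ) + 1))) * cq q with hV
  have hVd : Differentiable ℂ V := fun s =>
    (hasDerivAt_one_sub_mul_cpow _ _ _ s).differentiableAt
  have hVi : ∀ s : ℂ, 1 < s.re → V s = localLFactor q (s + 1) * whittaker (t : ℚ_[q]) 1 s :=
    fun s hs => by rw [localLFactor_eq_one hq, one_mul, whittaker_one hq ht (one_pos.trans hs)]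
  constructor
  · intro h s
    have hW : AnalyticOnNhd ℂ W Set.univ := fun z _ => h.entire.analyticAt z
    have hVa : AnalyticOnNhd ℂ V Set.univ := fun z _ => hVd.analyticAt z
    refine congrFun (hW.eq_of_eventuallyEq hVa (z₀ := 2) ?_) s
    filter_upwards [(isOpen_lt continuous_const Complex.continuous_re).mem_nhds
      (show (1 : ℝ) < (2 : ℂ).re by norm_num)] with z hz
    rw [h.eq_integral z hz, hVi z hz]
  · intro h
    obtain rfl : W = V := funext h
    exact ⟨hVd, hVi⟩

end Continuation

end LocalWhittaker

end

theorem proposition2p7 (q : ℕ) [Fact q.Prime] (hq3 : 3 < q) (hq : q % 4 = 3)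
    (t : ℤ) (ht : t ≠ 0) :
    -- absolute convergence of the Whittaker integral
    (∀ s : ℂ, 1 < s.re →
      MeasureTheory.Integrable
        (LocalWhittaker.whittakerIntegrand (q := q) (t : ℚ_[q]) 1 s) (LocalWhittaker.haarQ q)) ∧
    -- existence of the analytic continuation
    (∃ W : ℂ → ℂ, LocalWhittaker.IsNormalizedWhittaker (q := q) (t : ℚ_[q]) W) ∧
    LocalWhittaker.rhoLocal q t = 1 ∧
    ∀ W : ℂ → ℂ, LocalWhittaker.IsNormalizedWhittaker (q := q) (t : ℚ_[q]) W →
      (∀ s : ℂ, W s =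
        (1 - (LocalWhittaker.chi (t : ℚ_[q]) : ℂ) *
          (q : ℂ) ^ (-s * ((padicValInt q t : ℂ) + 1))) * LocalWhittaker.cq q) ∧
      (LocalWhittaker.chi (t : ℚ_[q]) = -1 →
        W 0 = 2 * LocalWhittaker.cq q * (LocalWhittaker.rhoLocal q t : ℂ)) ∧
      (LocalWhittaker.chi (t : ℚ_[q]) = 1 →
        W 0 = 0 ∧
        HasDerivAt W
          (LocalWhittaker.cq q * (Real.log q : ℂ) * ((padicValInt q t : ℂ) + 1) *
            (LocalWhittaker.rhoLocal q t : ℂ)) 0) := by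
  have hiff := LocalWhittaker.isNormalizedWhittaker_iff (q := q) hq ht
  have hrho := LocalWhittaker.rhoLocal_eq_one q t
  refine ⟨fun s hs => LocalWhittaker.integrable_whittakerIntegrand hq (Padic.norm_int_le_one t)
    (one_pos.trans hs), ⟨_, (hiff _).mpr fun _ => rfl⟩, hrho, fun W hW => ?_⟩
  have hs := (hiff W).mp hW
  refine ⟨hs, fun hchi => ?_, fun hchi => ⟨?_, ?_⟩⟩
  · rw [hs, hchi, hrho]
    norm_num
  · rw [hs, hchi]
    simp
  · rw [funext hs, hchi, hrho]
    convert LocalWhittaker.hasDerivAt_one_sub_mul_cpow (q := q) ((1 : ℤ) : ℂ)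
      (LocalWhittaker.cq q) ((padicValInt q t : ℂ) + 1) 0 using 1
    simp
    ring
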